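/- **Types and terms.** Base types are $b ::= \mathbf 1 \mid b_1+b_2 \mid b_1\times b_2 \mid L(b)$; simple types are base types and arrow types $b_1\to b_2$. Terms, in let-normal form (the arguments of constructors, destructors and applications are variables), are $$\begin{aligned}e ::=\ & x \mid f \mid \langle\rangle \mid \mathsf{inl}\,x \mid \mathsf{inr}\,x \mid \langle x_1,x_2\rangle \mid [\,] \mid x_1::x_2 \mid \lambda x.e \mid f\,x \mid \mathsf{tick}\,q \mid \mathsf{case}\,x\,\{\mathsf{inl}\,y_1\hookrightarrow e_1\mid \mathsf{inr}\,y_2\hookrightarrow e_2\} \mid \mathsf{case}\,x\,\{\langle x_1,x_2\rangle\hookrightarrow e\}\\ & \mid \mathsf{case}\,x\,\{[\,]\hookrightarrow e_0\mid (y::ys)\hookrightarrow e_1\} \mid \mathsf{let}\,x=e_1\,\mathsf{in}\,e_2 \mid \mathsf{share}\,x\,\mathsf{as}\,x_1,x_2\,\mathsf{in}\,e \mid \mathsf{rec}\,x\,\{[\,]\hookrightarrow e_0\mid (y::ys)\,\mathsf{with}\,z\hookrightarrow e_1\},\end{aligned}$$ where $\mathsf{let}$ and $\mathsf{share}$ also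 exist for arrow-type variables. Every variable has a fixed type. A context is a finite set $\Sigma$ of arrow-type variables with a finite set $\Gamma$ of base-type variables; typing is affine, so in a union $\Sigma_1,\Sigma_2$ or $\Gamma_1,\Gamma_2$ and in an extension $\Gamma,x$ the parts are disjoint, and newly bound variables are fresh. **Inherently polynomial time.** A set $\Delta$ of pairs $(f,t)$ with $t\in\{\mathsf{const},\mathsf{poly}\}$ records the time classes of arrow-type variables. For simply typed terms, the judgments $\Delta;\Sigma;\Gamma\vdash e\ \mathsf{inhpoly}\,V$ ($e$ of base type, $V\subseteq\Gamma$) and $\Delta;\Sigma;\cdot\vdash e\ t$ ($e$ of arrow type) are inductively defined by the following rules, where $V[x\mapsto W]$ is $(V\setminus\{x\})\cup W$ if $x\in V$, and $V$ otherwise. 1. Axioms (with $\Delta$, $\Sigma$, $\Gamma$ holding just what the term mentions): a base-type variable, $\mathsf{inl}\,x$, $\mathsf{inr}\,x$, $\langle x_1,x_2\rangle$, $\langle\rangle$, $[\,]$ and $x_1::x_2$ are $\mathsf{inhpoly}\,\emptyset$; if $\Delta=\{(f,t)\}$, then $f$ is $t$, and $f\,x$ is $\mathsf{inhpoly}\,\emptyset$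 for $t=\mathsf{const}$ and $\mathsf{inhpoly}\{x\}$ for $t=\mathsf{poly}$. 2. A $\mathsf{case}$ on $x$ in context $\Gamma,x$ is $\mathsf{inhpoly}\,V$ if each branch is $\mathsf{inhpoly}\,V[x\mapsto W]$, where $W$ is the set of variables bound in that branch ($W=\emptyset$ for $[\,]$). 3. If $\Delta;\Sigma;\Gamma\vdash e_0\ \mathsf{inhpoly}\,V$ and $\emptyset;\cdot;y,ys,z\vdash e_1\ \mathsf{inhpoly}\{y,ys\}$, then $\Delta;\Sigma;\Gamma,x\vdash\mathsf{rec}\,x\,\{[\,]\hookrightarrow e_0\mid(y::ys)\,\mathsf{with}\,z\hookrightarrow e_1\}\ \mathsf{inhpoly}\,(V\cup\{x\})$. 4. If $\Delta_1;\Sigma_1;\Gamma_1\vdash e_1\ \mathsf{inhpoly}\,V_1$ and $\Delta_2;\Sigma_2;\Gamma_2,x\vdash e_2\ \mathsf{inhpoly}\,V_2$, then $\Delta_1,\Delta_2;\Sigma_1,\Sigma_2;\Gamma_1,\Gamma_2\vdash\mathsf{let}\,x=e_1\,\mathsf{in}\,e_2\ \mathsf{inhpoly}\,V_3$ with $V_3=\Gamma_1\cup(V_2\setminus\{x\})$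 if $x\in V_2$ and $V_3=V_1\cup V_2$ otherwise. If $\Delta_1;\Sigma_1;\cdot\vdash e_1\ t$ and $\Delta_2,(f,t);\Sigma_2,f;\Gamma\vdash e_2\ \mathsf{inhpoly}\,V$, then $\Delta_1,\Delta_2;\Sigma_1,\Sigma_2;\Gamma\vdash\mathsf{let}\,f=e_1\,\mathsf{in}\,e_2\ \mathsf{inhpoly}\,V$. 5. $\mathsf{share}\,x\,\mathsf{as}\,x_1,x_2\,\mathsf{in}\,e$ is $\mathsf{inhpoly}\,V$ if $e$ is $\mathsf{inhpoly}\,V[x\mapsto\{x_1,x_2\}]$; $\mathsf{share}\,f\,\mathsf{as}\,f_1,f_2\,\mathsf{in}\,e$ is $\mathsf{inhpoly}\,V$ if $e$ is, where in $\Delta$ each $(f,t)$ is replaced by $(f_1,t),(f_2,t)$. 6. Weakening for terms of base type: $\Delta$, $\Sigma$, $\Gamma$ and $V$ may be enlarged ($V\subseteq\Gamma$, and $\Delta$ mentions variables of $\Sigma$ only). 7. $\lambda x.e$ is $\mathsf{const}$ if $\Delta;\Sigma;x\vdash e\ \mathsf{inhpoly}\,\emptyset$, and $\mathsf{poly}$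 if $\Delta;\Sigma;x\vdash e\ \mathsf{inhpoly}\{x\}$. **Assumption 1** on a derivation: for every subderivation $\Delta_s;\Sigma_s;\Gamma_s\vdash e_s\ \mathsf{inhpoly}\,V_s$, (i) if $e_s$ is $\mathsf{share}\,v\,\mathsf{as}\,v_1,v_2\,\mathsf{in}\cdots$ with $v$ of base type, then $v\in V_s$; (ii) if $e_s$ is $\mathsf{case}\,x\,\{[\,]\hookrightarrow\cdots\mid(y::ys)\hookrightarrow\cdots\}$ with $x:L(b)$, then $b$ contains no list type. **Annotations.** The index sets are $\mathcal I(\mathbf 1)=\{*\}$, $\mathcal I(b_1+b_2)=\mathcal I(b_1)\sqcup\mathcal I(b_2)$, $\mathcal I(b_1\times b_2)=\mathcal I(b_1)\times\mathcal I(b_2)$, and $\mathcal I(L(b))$ is the set of finite lists over $\mathcal I(b)$. Degrees: $\deg *=0$, an injected index keeps its degree, $\deg(i,j)=\deg i+\deg j$, $\deg[i_1,\dots,i_k]=k+\sum_m\deg i_m$. The base polynomials are $p_*=1$; $p_{\mathsf{inl}\,i}(\mathsf{inl}\,v)=p_i(v)$ and $p_{\mathsf{inl}\,i}(\mathsf{inr}\,v)=0$,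 symmetrically for $\mathsf{inr}$; $p_{(i,j)}(v,w)=p_i(v)p_j(w)$; $p_{[i_1,\dots,i_k]}([v_1,\dots,v_m])=\sum_{1\le j_1<\dots<j_k\le m}\prod_{l}p_{i_l}(v_{j_l})$. Let $\mathcal I(\Gamma)=\prod_{x:b\in\Gamma}\mathcal I(b)$. An annotation of $b$ or of $\Gamma$ is a finitely supported family of coefficients in $\mathbb Q_{\ge0}$ indexed by $\mathcal I(b)$ or $\mathcal I(\Gamma)$. Call an index *zero*, written $j\simeq0$, if its degree is $0$ (in every component, for a context); without sum types there is exactly one zero index, and in general the base polynomials of the zero indexes of a type sum to $1$. The annotation *constant $c$* is $c$ on the zero indexes and $0$ elsewhere. An annotation $Q$ of $b$ is *$\mathrm{uniform}(d,n)$*, for $d,n\in\mathbb N$, if $Q(i)=0$ whenever $\deg i>d$ and $Q(i)=n$ whenever $\deg i=d$. An annotation $P$ of $\Gamma$ is *$\mathrm{uniform}(d,n,V)$* if for every $v\in\Gamma\setminus V$, $i\in\mathcal I(\{v\})$ and $j\in\mathcal I(\Gamma\setminus\{v\})$: $P(i,j)=0$ if $\deg i>d$; $P(i,j)=0$ if $\deg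 i=d$ and $j\not\simeq0$; $P(i,j)=n$ if $\deg i=d$ and $j\simeq0$. **Cost-free multivariate AARA.** Each $f:b_1\to b_2$ in $\Sigma$ carries a set $T_f$ of annotated arrow types $\langle b_1,P\rangle\to\langle b_2,Q\rangle$. The judgment $\Sigma;\Gamma;P\vdash e:B$, with $B=\langle b,Q\rangle$ or $B=\langle b_1,P'\rangle\to\langle b_2,Q\rangle$, is inductively defined by the following rules. For an annotation $q$ of $L(b)$ put $(\lhd q)(j,k)=q(j::k)+[j\simeq0]\,q(k)$. * $x:\langle b,Q\rangle$ with $P=Q$; $\langle x_1,x_2\rangle:\langle b_1\times b_2,Q\rangle$ with $P=Q$; $\mathsf{inl}\,x$ with $P(i)=Q(\mathsf{inl}\,i)$; $\mathsf{inr}\,x$ with $P(i)=Q(\mathsf{inr}\,i)$; $\langle\rangle$ with $P=Q(*)$; $[\,]$ with $P=Q([\,])$; $x_1::x_2$ with $P=\lhd Q$; $f:\langle b_1,P'\rangle\to\langle b_2,Q\rangle$ with context annotation $0$, and $f\,x:\langle b_2,Q\rangle$ with $P=P'$, for every element $\langle b_1,P'\rangle\to\langle b_2,Q\rangle$ of $T_f$.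 * $\lambda x.e:\langle b_1,P'\rangle\to\langle b_2,Q\rangle$ with context annotation $0$, if $\Sigma;x;P'\vdash e:\langle b_2,Q\rangle$. * Pattern matching on $x$ in $\Gamma,x$ with annotation $P$ types at $B$ if the branches do, with annotations $P_1(\gamma,i)=P(\gamma,\mathsf{inl}\,i)$ and $P_2(\gamma,i)=P(\gamma,\mathsf{inr}\,i)$ for sums; $P_1(\gamma,i_1,i_2)=P(\gamma,(i_1,i_2))$ for products; $P_0(\gamma)=P(\gamma,[\,])$ and $P_1(\gamma,j,k)=(\lhd P(\gamma,\cdot))(j,k)$ for lists. * $\Sigma_1,\Sigma_2;\Gamma_1,\Gamma_2;P\vdash\mathsf{let}\,x=e_1\,\mathsf{in}\,e_2:B$ if there is an annotation $R$ of $\Gamma_2,x$ with $\Sigma_2;\Gamma_2,x;R\vdash e_2:B$ and, for every $j\in\mathcal I(\Gamma_2)$, $\Sigma_1;\Gamma_1;P(\cdot,j)\vdash e_1:\langle b_x,R(j,\cdot)\rangle$. * $\Sigma_1,\Sigma_2;\Gamma;P\vdash\mathsf{let}\,f=e_1\,\mathsf{in}\,e_2:B$ if $\Sigma_1;\cdot;0\vdash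 e_1:A$ for all $A$ in some set $T_f$, and $\Sigma_2,f;\Gamma;P\vdash e_2:B$ with that $T_f$. * $\mathsf{share}\,x\,\mathsf{as}\,x_1,x_2\,\mathsf{in}\,e$ types at $B$ with $P$ if $e$ does with some $P_1$ such that $\sum_kP(\gamma,k)p_k(v)=\sum_{k_1,k_2}P_1(\gamma,k_1,k_2)p_{k_1}(v)p_{k_2}(v)$ for all $\gamma\in\mathcal I(\Gamma)$ and all values $v$; for $\mathsf{share}\,f\,\mathsf{as}\,f_1,f_2$ put $T_{f_1}=T_{f_2}=T_f$. * $\mathsf{rec}\,x\,\{[\,]\hookrightarrow e_0\mid(y::ys)\,\mathsf{with}\,z\hookrightarrow e_1\}$ is typed as $f\langle x,\Gamma\rangle$ for the recursive function $f\langle x,\Gamma\rangle=\mathsf{case}\,x\,\{[\,]\hookrightarrow e_0\mid(y::ys)\hookrightarrow\mathsf{share}\,ys\,\mathsf{as}\,ys_1,ys_2\,\mathsf{in}\,\mathsf{let}\,z=f\langle ys_1,\Gamma\rangle\,\mathsf{in}\,e_1\}$, with resource-polymorphic recursion of decreasing degree. That is, $\Sigma;\Gamma,x;P\vdash\mathsf{rec}\cdots:\langle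 b_2,Q\rangle$ if there are annotations $P'_{j,k}$ of $\Gamma,x$ and $Q'_{j,k}$ of $b_2$ for $j\in\mathcal I(b)$, $k\in\mathcal I(L(b))$ (almost all of them $0$) such that: $\Sigma;\Gamma;P(\cdot,[\,])\vdash e_0:\langle b_2,Q\rangle$; $\cdot;y,ys,z;P_1\vdash e_1:\langle b_2,Q\rangle$ with $P_1(j,k,i)=[(j,k)\simeq0]\,Q(i)+Q'_{j,k}(i)$; for all $\gamma$, $j$ and $v$, $\sum_k(\lhd P(\gamma,\cdot))(j,k)\,p_k(v)=\sum_{k_1,k_2}\big([(j,k_2)\simeq0]\,P(\gamma,k_1)+P'_{j,k_2}(\gamma,k_1)\big)p_{k_1}(v)p_{k_2}(v)$; every $Q'_{j,k}$ is $0$ or has a strictly smaller degree than $Q$; and $\Sigma;\Gamma,x;P'_{j,k}\vdash\mathsf{rec}\cdots:\langle b_2,Q'_{j,k}\rangle$ unless $P'_{j,k}=0$ and $Q'_{j,k}=0$. * Structural rules: the context annotation may be increased; an output annotation $Q$ of base type may be decreased; $\Sigma,\Gamma_1$ with $P_1$ may be weakened to larger contexts with any $P_2$ that satisfies $P_2(i,j)=P_1(i)$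 for $j\simeq0$; the same constant $c\ge0$ may be added to $P$ and to $Q$. **Theorem.** Let $\Delta$ and $\Sigma$ be given, let $\Sigma$ be annotated by sets $T_f$, and suppose that these fit $\Delta$: if $(f,t)\in\Delta$ with $f:b_1\to b_2$, then for all $d,n\in\mathbb N$ and every $\mathrm{uniform}(d,n)$ annotation $Q$ of $b_2$, there is a $P$ with $(\langle b_1,P\rangle\to\langle b_2,Q\rangle)\in T_f$, where $P$ is $\mathrm{uniform}(d,n)$ if $t=\mathsf{const}$ or $d=0$. (This is vacuous if $\Sigma$ and $\Delta$ are empty.) 1. If $\Sigma;\Gamma\vdash e:b$ is a term of base type and $\Delta;\Sigma;\Gamma\vdash e\ \mathsf{inhpoly}\,V$ has a derivation satisfying Assumption 1, then for all $d,n\in\mathbb N$ and every annotation $Q$ of $b$ that is $\mathrm{uniform}(d,n)$, there is an annotation $P$ of $\Gamma$ such that $\Sigma;\Gamma;P\vdash e:\langle b,Q\rangle$ under the cost-free metric and $P$ is $\mathrm{uniform}(d,n,V)$. 2. If $\Sigma;\cdot\vdash e:b_1\to b_2$ is a term of arrow type and $\Delta;\Sigma;\cdot\vdash e\ t$ with $t\in\{\mathsf{const},\mathsf{poly}\}$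 has a derivation satisfying Assumption 1, then for all $d,n\in\mathbb N$ and every annotation $Q$ of $b_2$ that is $\mathrm{uniform}(d,n)$, there is an annotation $P$ of $b_1$ such that $\Sigma;\cdot;0\vdash e:\langle b_1,P\rangle\to\langle b_2,Q\rangle$ under the cost-free metric, and $P$ is $\mathrm{uniform}(d,n)$ if $t=\mathsf{const}$ (and also if $d=0$). -/

import Mathlib

noncomputable section

namespace RaML

/-! ### Types, variables and terms -/

/-- Base types `b ::= 1 | b₁ + b₂ | b₁ × b₂ | L(b)`. -/
inductive Ty : Type
  | unit : Ty
  | sum : Ty → Ty → Ty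
  | prod : Ty → Ty → Ty
  | list : Ty → Ty
  deriving DecidableEq

/-- The base type `b` contains no list type. -/
def Ty.ListFree : Ty → Prop
  | .unit => True
  | .sum a b => a.ListFree ∧ b.ListFree
  | .prod a b => a.ListFree ∧ b.ListFree
  | .list _ => False

/-- Simple types: base types and first-order arrow types `b₁ → b₂`. -/
inductive STy : Type
  | base : Ty → STy
  | arrow : Ty → Ty → STy

/-- Variable symbols of base type. Every symbol carries its type (there are countably many
symbols of each type), so that a typing context is just a finite set of symbols. -/
structure BVar : Type where
  name : ℕ
  ty : Ty
  deriving DecidableEq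

/-- Variable symbols of arrow type `dom → cod`. -/
structure FVar : Type where
  name : ℕ
  dom : Ty
  cod : Ty
  deriving DecidableEq

/-- Terms in let-normal form, with primitive recursion and `λ` in place of general recursion.
`primrec x e₀ y ys z e₁` is `rec x {[] ↪ e₀ | (y::ys) with z ↪ e₁}`. -/
inductive Tm : Type
  | var (x : BVar)
  | fvar (f : FVar)
  | unit
  | inl (x : BVar) (b₂ : Ty)
  | inr (b₁ : Ty) (x : BVar)
  | caseSum (x y₁ : BVar) (e₁ : Tm) (y₂ : BVar) (e₂ : Tm)
  | pair (x₁ x₂ : BVar)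
  | casePair (x x₁ x₂ : BVar) (e : Tm)
  | nil (b : Ty)
  | cons (x₁ x₂ : BVar)
  | caseList (x : BVar) (e₀ : Tm) (y ys : BVar) (e₁ : Tm)
  | lam (x : BVar) (e : Tm)
  | app (f : FVar) (x : BVar)
  | tick (q : ℚ)
  | letBase (x : BVar) (e₁ e₂ : Tm)
  | letArrow (f : FVar) (e₁ e₂ : Tm)
  | shareBase (x x₁ x₂ : BVar) (e : Tm)
  | shareArrow (f f₁ f₂ : FVar) (e : Tm)
  | primrec (x : BVar) (e₀ : Tm) (y ys z : BVar) (e₁ : Tm)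

/-! ### Inherently polynomial time -/

/-- The two time classes of a function. -/
inductive Time : Type
  | const : Time
  | poly : Time

/-- What is asserted of a term: `inhpoly V` for base-type terms, `const` or `poly` for
arrow-type terms. -/
inductive Claim : Type
  | inhpoly : Finset BVar → Claim
  | time : Time → Claim

/-- `V[x ↦ W]`: the variable `x`, if it is in `V`, is replaced by the variables in `W`. -/
def replaceVar (V : Finset BVar) (x : BVar) (W : Finset BVar) : Finset BVar :=
  if x ∈ V then V.erase x ∪ W else V

/-- The context `x, y, z`. -/
abbrev ctx₃ (x y z : BVar) : Finset BVar := {x, y, z}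

/-- `Δ[f time ↦ f₁ time, f₂ time]`. -/
def replaceFun (Δ : Set (FVar × Time)) (f f₁ f₂ : FVar) : Set (FVar × Time) :=
  {p | (p ∈ Δ ∧ p.1 ≠ f) ∨ ((p.1 = f₁ ∨ p.1 = f₂) ∧ (f, p.2) ∈ Δ)}

/-- `Δ` only speaks about the arrow-type variables in `S`. -/
def Declared (Δ : Set (FVar × Time)) (S : Finset FVar) : Prop := ∀ p ∈ Δ, p.1 ∈ S

/-- `InhPoly r Δ S Γ e τ c` is the judgment `Δ; S; Γ ⊢ e : τ` together with the claim `c`, i.e.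
`Δ; S; Γ ⊢ e inhpoly V` for a base-type term, or `Δ; S; Γ ⊢ e const` / `poly` for an arrow-type
term. The judgment presupposes that `e` is simply typed, so the type is carried along.

If the proposition `r` is true, only those derivations count in which, at every subterm,
(i) a shared base-type variable `v` belongs to the set `V` of that subterm, and
(ii) pattern matching on lists is only applied to lists whose element type contains no list
type. With `r` false there is no restriction. -/
inductive InhPoly (r : Prop) : Set (FVar × Time) → Finset FVar → Finset BVar → Tm → STy →
    Claim → Prop
  | base (x : BVar) : InhPoly r ∅ ∅ {x} (.var x) (.base x.ty) (.inhpoly ∅)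
  | arrow (f : FVar) (t : Time) :
      InhPoly r {(f, t)} {f} ∅ (.fvar f) (.arrow f.dom f.cod) (.time t)
  | sumL (x : BVar) (b₂ : Ty) :
      InhPoly r ∅ ∅ {x} (.inl x b₂) (.base (.sum x.ty b₂)) (.inhpoly ∅)
  | sumR (x : BVar) (b₁ : Ty) :
      InhPoly r ∅ ∅ {x} (.inr b₁ x) (.base (.sum b₁ x.ty)) (.inhpoly ∅)
  | pair (x₁ x₂ : BVar) (hne : x₁ ≠ x₂) :
      InhPoly r ∅ ∅ {x₁, x₂} (.pair x₁ x₂) (.base (.prod x₁.ty x₂.ty)) (.inhpoly ∅)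
  | unit : InhPoly r ∅ ∅ ∅ .unit (.base .unit) (.inhpoly ∅)
  | nil (b : Ty) : InhPoly r ∅ ∅ ∅ (.nil b) (.base (.list b)) (.inhpoly ∅)
  | cons (n₁ n₂ : ℕ) (b : Ty) :
      InhPoly r ∅ ∅ {BVar.mk n₁ b, BVar.mk n₂ (.list b)}
        (.cons (BVar.mk n₁ b) (BVar.mk n₂ (.list b))) (.base (.list b))
        (.inhpoly ∅)
  | appConst (n m : ℕ) (b₁ b₂ : Ty) :
      InhPoly r {(⟨n, b₁, b₂⟩, .const)} {⟨n, b₁, b₂⟩} {BVar.mk m b₁}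
        (.app ⟨n, b₁, b₂⟩ (BVar.mk m b₁))
        (.base b₂) (.inhpoly ∅)
  | appPoly (n m : ℕ) (b₁ b₂ : Ty) :
      InhPoly r {(⟨n, b₁, b₂⟩, .poly)} {⟨n, b₁, b₂⟩} {BVar.mk m b₁}
        (.app ⟨n, b₁, b₂⟩ (BVar.mk m b₁))
        (.base b₂) (.inhpoly {BVar.mk m b₁})
  | caseSum {Δ : Set (FVar × Time)} {S : Finset FVar} {Γ V : Finset BVar} {e₁ e₂ : Tm} {b : Ty}
      (x y₁ y₂ : ℕ) (b₁ b₂ : Ty)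
      (hx : BVar.mk x (.sum b₁ b₂) ∉ Γ) (hy₁ : BVar.mk y₁ b₁ ∉ Γ) (hy₂ : BVar.mk y₂ b₂ ∉ Γ)
      (hV : V ⊆ insert (BVar.mk x (.sum b₁ b₂)) Γ)
      (h₁ : InhPoly r Δ S (insert (BVar.mk y₁ b₁) Γ) e₁ (.base b)
        (.inhpoly (replaceVar V (BVar.mk x (.sum b₁ b₂)) {BVar.mk y₁ b₁})))
      (h₂ : InhPoly r Δ S (insert (BVar.mk y₂ b₂) Γ) e₂ (.base b)
        (.inhpoly (replaceVar V (BVar.mk x (.sum b₁ b₂)) {BVar.mk y₂ b₂}))) :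
      InhPoly r Δ S (insert (BVar.mk x (.sum b₁ b₂)) Γ)
        (.caseSum (BVar.mk x (.sum b₁ b₂)) (BVar.mk y₁ b₁) e₁ (BVar.mk y₂ b₂) e₂) (.base b)
          (.inhpoly V)
  | caseProd {Δ : Set (FVar × Time)} {S : Finset FVar} {Γ V : Finset BVar} {e : Tm} {b : Ty}
      (x x₁ x₂ : ℕ) (b₁ b₂ : Ty)
      (hx : BVar.mk x (.prod b₁ b₂) ∉ Γ) (hx₁ : BVar.mk x₁ b₁ ∉ Γ) (hx₂ : BVar.mk x₂ b₂ ∉ Γ)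
      (hne : BVar.mk x₁ b₁ ≠ BVar.mk x₂ b₂)
      (hV : V ⊆ insert (BVar.mk x (.prod b₁ b₂)) Γ)
      (h : InhPoly r Δ S (insert (BVar.mk x₁ b₁) (insert (BVar.mk x₂ b₂) Γ)) e (.base b)
        (.inhpoly (replaceVar V (BVar.mk x (.prod b₁ b₂)) {BVar.mk x₁ b₁, BVar.mk x₂ b₂}))) :
      InhPoly r Δ S (insert (BVar.mk x (.prod b₁ b₂)) Γ)
        (.casePair (BVar.mk x (.prod b₁ b₂)) (BVar.mk x₁ b₁) (BVar.mk x₂ b₂) e) (.base b)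
          (.inhpoly V)
  | caseList {Δ : Set (FVar × Time)} {S : Finset FVar} {Γ V : Finset BVar} {e₀ e₁ : Tm}
      {b₂ : Ty} (x y ys : ℕ) (b : Ty) (hr : r → b.ListFree)
      (hx : BVar.mk x (.list b) ∉ Γ) (hy : BVar.mk y b ∉ Γ) (hys : BVar.mk ys (.list b) ∉ Γ)
      (hV : V ⊆ insert (BVar.mk x (.list b)) Γ)
      (h₀ : InhPoly r Δ S Γ e₀ (.base b₂) (.inhpoly (V.erase (BVar.mk x (.list b)))))
      (h₁ : InhPoly r Δ S (insert (BVar.mk y b) (insert (BVar.mk ys (.list b)) Γ)) e₁ (.base b₂)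
        (.inhpoly (replaceVar V (BVar.mk x (.list b)) {BVar.mk y b, BVar.mk ys (.list b)}))) :
      InhPoly r Δ S (insert (BVar.mk x (.list b)) Γ)
        (.caseList (BVar.mk x (.list b)) e₀ (BVar.mk y b) (BVar.mk ys (.list b)) e₁) (.base b₂)
          (.inhpoly V)
  | primrec {Δ : Set (FVar × Time)} {S : Finset FVar} {Γ V : Finset BVar} {e₀ e₁ : Tm}
      (x y ys z : ℕ) (b b₂ : Ty)
      (hx : BVar.mk x (.list b) ∉ Γ)
      (hzy : BVar.mk z b₂ ≠ BVar.mk y b) (hzys : BVar.mk z b₂ ≠ BVar.mk ys (.list b))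
      (h₀ : InhPoly r Δ S Γ e₀ (.base b₂) (.inhpoly V))
      (h₁ : InhPoly r ∅ ∅ (ctx₃ (BVar.mk y b) (BVar.mk ys (.list b)) (BVar.mk z b₂)) e₁ (.base b₂)
        (.inhpoly {BVar.mk y b, BVar.mk ys (.list b)})) :
      InhPoly r Δ S (insert (BVar.mk x (.list b)) Γ)
        (.primrec (BVar.mk x (.list b)) e₀ (BVar.mk y b) (BVar.mk ys (.list b)) (BVar.mk z b₂) e₁)
          (.base b₂)
        (.inhpoly (V ∪ {BVar.mk x (.list b)}))
  | letBase {Δ₁ Δ₂ : Set (FVar × Time)} {S₁ S₂ : Finset FVar} {Γ₁ Γ₂ V₁ V₂ : Finset BVar}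
      {e₁ e₂ : Tm} {b : Ty} (x : BVar)
      (hS : Disjoint S₁ S₂) (hΓ : Disjoint Γ₁ Γ₂) (hx : x ∉ Γ₂)
      (h₁ : InhPoly r Δ₁ S₁ Γ₁ e₁ (.base x.ty) (.inhpoly V₁))
      (h₂ : InhPoly r Δ₂ S₂ (insert x Γ₂) e₂ (.base b) (.inhpoly V₂)) :
      InhPoly r (Δ₁ ∪ Δ₂) (S₁ ∪ S₂) (Γ₁ ∪ Γ₂) (.letBase x e₁ e₂) (.base b)
        (.inhpoly (if x ∈ V₂ then Γ₁ ∪ V₂.erase x else V₁ ∪ V₂))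
  | letArrow {Δ₁ Δ₂ : Set (FVar × Time)} {S₁ S₂ : Finset FVar} {Γ V : Finset BVar}
      {e₁ e₂ : Tm} {b : Ty} (f : FVar) (t : Time)
      (hS : Disjoint S₁ S₂) (hf : f ∉ S₂) (hΔ : Declared Δ₂ S₂)
      (h₁ : InhPoly r Δ₁ S₁ ∅ e₁ (.arrow f.dom f.cod) (.time t))
      (h₂ : InhPoly r (insert (f, t) Δ₂) (insert f S₂) Γ e₂ (.base b) (.inhpoly V)) :
      InhPoly r (Δ₁ ∪ Δ₂) (S₁ ∪ S₂) Γ (.letArrow f e₁ e₂) (.base b) (.inhpoly V)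
  | shareBase {Δ : Set (FVar × Time)} {S : Finset FVar} {Γ V : Finset BVar} {e : Tm} {b : Ty}
      (x x₁ x₂ : ℕ) (b' : Ty) (hr : r → (BVar.mk x b') ∈ V)
      (hx : BVar.mk x b' ∉ Γ) (hx₁ : BVar.mk x₁ b' ∉ Γ) (hx₂ : BVar.mk x₂ b' ∉ Γ) (hne : x₁ ≠ x₂)
      (hV : V ⊆ insert (BVar.mk x b') Γ)
      (h : InhPoly r Δ S (insert (BVar.mk x₁ b') (insert (BVar.mk x₂ b') Γ)) e (.base b)
        (.inhpoly (replaceVar V (BVar.mk x b') {BVar.mk x₁ b', BVar.mk x₂ b'}))) :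
      InhPoly r Δ S (insert (BVar.mk x b') Γ)
        (.shareBase (BVar.mk x b') (BVar.mk x₁ b') (BVar.mk x₂ b') e) (.base b)
        (.inhpoly V)
  | shareArrow {Δ : Set (FVar × Time)} {S : Finset FVar} {Γ V : Finset BVar} {e : Tm} {b : Ty}
      (f f₁ f₂ : ℕ) (b₁ b₂ : Ty)
      (hf : ⟨f, b₁, b₂⟩ ∉ S) (hf₁ : ⟨f₁, b₁, b₂⟩ ∉ S) (hf₂ : ⟨f₂, b₁, b₂⟩ ∉ S) (hne : f₁ ≠ f₂)
      (hΔ : Declared Δ (insert ⟨f, b₁, b₂⟩ S))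
      (h : InhPoly r (replaceFun Δ ⟨f, b₁, b₂⟩ ⟨f₁, b₁, b₂⟩ ⟨f₂, b₁, b₂⟩)
        (insert ⟨f₁, b₁, b₂⟩ (insert ⟨f₂, b₁, b₂⟩ S)) Γ e (.base b) (.inhpoly V)) :
      InhPoly r Δ (insert ⟨f, b₁, b₂⟩ S) Γ
        (.shareArrow ⟨f, b₁, b₂⟩ ⟨f₁, b₁, b₂⟩ ⟨f₂, b₁, b₂⟩ e) (.base b) (.inhpoly V)
  | weakenBase {Δ₁ Δ₂ : Set (FVar × Time)} {S₁ S₂ : Finset FVar} {Γ₁ Γ₂ V₁ V₂ : Finset BVar}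
      {e : Tm} {b : Ty}
      (hΔ : Δ₁ ⊆ Δ₂) (hS : S₁ ⊆ S₂) (hΓ : Γ₁ ⊆ Γ₂) (hV : V₁ ⊆ V₂)
      (hΔ₂ : Declared Δ₂ S₂) (hV₂ : V₂ ⊆ Γ₂)
      (h : InhPoly r Δ₁ S₁ Γ₁ e (.base b) (.inhpoly V₁)) :
      InhPoly r Δ₂ S₂ Γ₂ e (.base b) (.inhpoly V₂)
  | const {Δ : Set (FVar × Time)} {S : Finset FVar} {e : Tm} {b : Ty} (x : BVar)
      (h : InhPoly r Δ S {x} e (.base b) (.inhpoly ∅)) :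
      InhPoly r Δ S ∅ (.lam x e) (.arrow x.ty b) (.time .const)
  | poly {Δ : Set (FVar × Time)} {S : Finset FVar} {e : Tm} {b : Ty} (x : BVar)
      (h : InhPoly r Δ S {x} e (.base b) (.inhpoly {x})) :
      InhPoly r Δ S ∅ (.lam x e) (.arrow x.ty b) (.time .poly)

/-! ### Multivariate resource annotations -/

/-- Semantic values of a base type. -/
def Val : Ty → Type
  | .unit => Unit
  | .sum a b => Val a ⊕ Val b
  | .prod a b => Val a × Val b
  | .list b => List (Val b)

/-- Indexes of the base polynomials of a base type. -/
def Idx : Ty → Type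
  | .unit => Unit
  | .sum a b => Idx a ⊕ Idx b
  | .prod a b => Idx a × Idx b
  | .list b => List (Idx b)

/-- The degree of an index. -/
def deg : (b : Ty) → Idx b → ℕ
  | .unit, _ => 0
  | .sum a b, i => Sum.elim (deg a) (deg b) i
  | .prod a b, (i : Idx a × Idx b) => deg a i.1 + deg b i.2
  | .list b, (l : List (Idx b)) => l.length + (l.map (deg b)).sum

/-- The base polynomial with a given index. For a list it is the sum, over all
`j₁ < ⋯ < j_k`, of the products `∏ p_{i_m}(v_{j_m})`; a wrong tag gives `0`. -/
def basePoly : (b : Ty) → Idx b → Val b → ℕ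
  | .unit, _, _ => 1
  | .sum a b, i, v =>
      Sum.elim (fun i => Sum.elim (fun v => basePoly a i v) (fun _ => 0) v)
        (fun i => Sum.elim (fun _ => 0) (fun v => basePoly b i v) v) i
  | .prod a b, (i : Idx a × Idx b), (v : Val a × Val b) =>
      basePoly a i.1 v.1 * basePoly b i.2 v.2
  | .list b, (l : List (Idx b)), (v : List (Val b)) =>
      ((v.sublistsLen l.length).map fun w => (List.zipWith (basePoly b) l w).prod).sum

/-- The multivariate annotations (resource polynomials) of a base type: finitely supported
families of nonnegative rational coefficients. -/
abbrev Ann (b : Ty) : Type := Idx b →₀ NNRat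

/-- Indexes for a base-type typing context: an index for each of its variables. -/
abbrev CIdx (Γ : Finset BVar) : Type := ∀ x : BVar, x ∈ Γ → Idx x.ty

/-- The multivariate annotations of a base-type typing context. -/
abbrev CAnn (Γ : Finset BVar) : Type := CIdx Γ →₀ NNRat

/-- The restriction of an index to a smaller context. -/
def CIdx.restrict {Γ Γ' : Finset BVar} (γ : CIdx Γ) (h : Γ' ⊆ Γ) : CIdx Γ' :=
  fun z hz => γ z (h hz)

/-- The index `(γ, k)` for `Γ, x`. -/
def CIdx.ext {Γ : Finset BVar} (γ : CIdx Γ) (x : BVar) (k : Idx x.ty) : CIdx (insert x Γ) :=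
  fun z hz => if h : z = x then h ▸ k else γ z (Finset.mem_of_mem_insert_of_ne hz h)

/-- The index `k` for the one-variable context `x`. -/
def CIdx.single (x : BVar) (k : Idx x.ty) : CIdx {x} :=
  fun _ hz => (Finset.mem_singleton.1 hz).symm ▸ k

/-- The index `(i, j, k)` for the context `x, y, z`. -/
def idx₃ (x y z : BVar) (i : Idx x.ty) (j : Idx y.ty) (k : Idx z.ty) : CIdx (ctx₃ x y z) :=
  ((CIdx.single z k).ext y j).ext x i

/-- The index `(i, j)` for `Γ₁ ∪ Γ₂`, where the two contexts are disjoint. -/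
def CIdx.join {Γ₁ Γ₂ : Finset BVar} (i : CIdx Γ₁) (j : CIdx Γ₂) : CIdx (Γ₁ ∪ Γ₂) :=
  fun z hz => if h : z ∈ Γ₁ then i z h else j z ((Finset.mem_union.1 hz).resolve_left h)

/-- `γ` has degree zero on all variables outside `Γ'`. The base polynomials of degree zero of a
type add up to the constant `1` (for a type without sums there is exactly one of them), so they
take the role of the index `0`. -/
def CIdx.ZeroOff {Γ : Finset BVar} (γ : CIdx Γ) (Γ' : Finset BVar) : Prop :=
  ∀ z (hz : z ∈ Γ), z ∉ Γ' → deg z.ty (γ z hz) = 0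

/-- The index `[]` of a list type; its base polynomial is the constant `1`. -/
def nilIdx (b : Ty) : Idx (.list b) := ([] : List (Idx b))

/-- The index `j :: k` of a list type. -/
def consIdx {b : Ty} (j : Idx b) (k : Idx (.list b)) : Idx (.list b) :=
  List.cons (α := Idx b) j k

/-- The coefficients `k ↦ P (γ, k)` of an annotation of `Γ, x`. -/
def slice {Γ : Finset BVar} (x : BVar) (P : CAnn (insert x Γ)) (γ : CIdx Γ) : Idx x.ty → NNRat :=
  fun k => P (γ.ext x k)

open Classical in
/-- The (multivariate) additive shift of `q` at `(j, k)`: `q(j::k)`, plus `q(k)` if `j` is `0`. -/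
def shift {b : Ty} (q : Idx (.list b) → NNRat) (j : Idx b) (k : Idx (.list b)) : NNRat :=
  q (consIdx j k) + if deg b j = 0 then q k else 0

open Classical in
/-- The coefficient `c` at an index that satisfies `z`, and `0` elsewhere. -/
def constCoeff (z : Prop) (c : NNRat) : NNRat := if z then c else 0

/-- The potential `∑ₖ q(k) pₖ(v)`. All sums used below have finite support. -/
def potential {b : Ty} (q : Idx b → NNRat) (v : Val b) : NNRat :=
  ∑ᶠ k : Idx b, q k * (basePoly b k v : NNRat)

/-- The potential `∑_{k₁, k₂} q(k₁, k₂) p_{k₁}(v) p_{k₂}(v)` of two copies of one value. -/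
def potential₂ {b : Ty} (q : Idx b → Idx b → NNRat) (v : Val b) : NNRat :=
  ∑ᶠ k : Idx b × Idx b, q k.1 k.2 * ((basePoly b k.1 v : NNRat) * (basePoly b k.2 v : NNRat))

/-- The annotation of a recursive call for the index `(j, k)` of head and tail: the annotation `p`
of the function itself if `(j, k)` is `0`, plus a further annotation `p'`. -/
def callCoeff {b : Ty} {α : Type} (p p' : α → NNRat) (j : Idx b) (k : Idx (.list b)) (i : α) :
    NNRat :=
  constCoeff (deg b j = 0 ∧ deg (.list b) k = 0) (p i) + p' i

/-- `Q uniform(d, n)` for an annotation of a base type. -/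
def Uniform {b : Ty} (Q : Ann b) (d n : ℕ) : Prop :=
  (∀ i, Q i ≠ 0 → deg b i ≤ d) ∧ ∀ i, deg b i = d → Q i = n

/-- `P uniform(d, n, V)` for an annotation of a typing context. -/
def CUniform {Γ : Finset BVar} (P : CAnn Γ) (d n : ℕ) (V : Finset BVar) : Prop :=
  ∀ v (hv : v ∈ Γ), v ∉ V →
    (∀ γ : CIdx Γ, d < deg v.ty (γ v hv) → P γ = 0) ∧
    (∀ γ : CIdx Γ, deg v.ty (γ v hv) = d → ¬ γ.ZeroOff {v} → P γ = 0) ∧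
    (∀ γ : CIdx Γ, deg v.ty (γ v hv) = d → γ.ZeroOff {v} → P γ = n)

/-! ### Multivariate AARA under the cost-free metric -/

/-- Annotated types `⟨b, Q⟩` and `⟨b₁, P⟩ → ⟨b₂, Q⟩`. -/
inductive ATy : Type
  | base (b : Ty) (Q : Ann b) : ATy
  | arrow (b₁ b₂ : Ty) (P : Ann b₁) (Q : Ann b₂) : ATy

/-- An annotation of arrow-type variables: to each one a set of annotated arrow types. -/
abbrev FAnn : Type := ∀ f : FVar, Set (Ann f.dom × Ann f.cod)

/-- `Typed T S Γ P e B` is the judgment `S; Γ; P ⊢ e : B` of multivariate AARA under the cost-free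
metric, where the arrow-type variables in `S` are annotated by `T`. For terms of arrow type `Γ` is
empty and `P` is `0` up to the structural rules.

In the rule for `x₁ :: x₂` and for pattern matching on lists the additive shift is used. The rule
`letBase` requires a cost-free typing of `e₁` for every index `j` of `Γ₂`.

The rule `primrec` is the typing of
`f ⟨x, Γ⟩ = case x {[] ↪ e₀ | y::ys ↪ share ys as ys₁, ys₂ in let z = f ⟨ys₁, Γ⟩ in e₁}` at
`P → Q`. The recursive call has to be typed for every index `j` of `y, ys₂`. It uses the type `P → Q`
itself (for the indexes `j` of degree zero) plus a further type `P'_j → Q'_j`, which is derived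
separately and whose output has a strictly smaller degree than `Q` (resource-polymorphic recursion
with decreasing degree). -/
inductive Typed : FAnn → Finset FVar → (Γ : Finset BVar) → CAnn Γ → Tm → ATy → Prop
  | var {T : FAnn} (x : BVar) (P : CAnn {x}) (Q : Ann x.ty)
      (hP : ∀ γ : CIdx {x}, P γ = Q (γ x (Finset.mem_singleton_self x))) :
      Typed T ∅ {x} P (.var x) (.base x.ty Q)
  | fvar {T : FAnn} (f : FVar) (P : Ann f.dom) (Q : Ann f.cod) (h : (P, Q) ∈ T f) :
      Typed T {f} ∅ 0 (.fvar f) (.arrow f.dom f.cod P Q)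
  | sumL {T : FAnn} (x : BVar) (b₂ : Ty) (P : CAnn {x}) (Q : Ann (.sum x.ty b₂))
      (hP : ∀ γ : CIdx {x}, P γ = Q (Sum.inl (γ x (Finset.mem_singleton_self x)))) :
      Typed T ∅ {x} P (.inl x b₂) (.base (.sum x.ty b₂) Q)
  | sumR {T : FAnn} (x : BVar) (b₁ : Ty) (P : CAnn {x}) (Q : Ann (.sum b₁ x.ty))
      (hP : ∀ γ : CIdx {x}, P γ = Q (Sum.inr (γ x (Finset.mem_singleton_self x)))) :
      Typed T ∅ {x} P (.inr b₁ x) (.base (.sum b₁ x.ty) Q)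
  | unit {T : FAnn} (P : CAnn ∅) (Q : Ann .unit) (hP : ∀ γ : CIdx ∅, P γ = Q ()) :
      Typed T ∅ ∅ P .unit (.base .unit Q)
  | pair {T : FAnn} (x₁ x₂ : BVar) (hne : x₁ ≠ x₂) (P : CAnn {x₁, x₂})
      (Q : Ann (.prod x₁.ty x₂.ty))
      (hP : ∀ γ : CIdx {x₁, x₂}, P γ = Q (γ x₁ (by simp), γ x₂ (by simp))) :
      Typed T ∅ {x₁, x₂} P (.pair x₁ x₂) (.base (.prod x₁.ty x₂.ty) Q)
  | nil {T : FAnn} (b : Ty) (P : CAnn ∅) (Q : Ann (.list b))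
      (hP : ∀ γ : CIdx ∅, P γ = Q (nilIdx b)) :
      Typed T ∅ ∅ P (.nil b) (.base (.list b) Q)
  | cons {T : FAnn} (x₁ x₂ : ℕ) (b : Ty) (P : CAnn {BVar.mk x₁ b, BVar.mk x₂ (.list b)})
    (Q : Ann (.list b))
      (hP : ∀ γ : CIdx {BVar.mk x₁ b, BVar.mk x₂ (.list b)},
        P γ = shift Q (γ (BVar.mk x₁ b) (by simp)) (γ (BVar.mk x₂ (.list b)) (by simp))) :
      Typed T ∅ {BVar.mk x₁ b, BVar.mk x₂ (.list b)} P
        (.cons (BVar.mk x₁ b) (BVar.mk x₂ (.list b))) (.base (.list b) Q)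
  | lam {T : FAnn} {S : Finset FVar} {e : Tm} (x : BVar) (b : Ty) (P : Ann x.ty) (Q : Ann b)
      (P' : CAnn {x}) (hP : ∀ γ : CIdx {x}, P' γ = P (γ x (Finset.mem_singleton_self x)))
      (h : Typed T S {x} P' e (.base b Q)) :
      Typed T S ∅ 0 (.lam x e) (.arrow x.ty b P Q)
  | app {T : FAnn} (f x : ℕ) (b₁ b₂ : Ty) (P : CAnn {BVar.mk x b₁}) (P' : Ann b₁) (Q : Ann b₂)
      (h : (P', Q) ∈ T ⟨f, b₁, b₂⟩)
      (hP : ∀ γ : CIdx {BVar.mk x b₁}, P γ = P' (γ (BVar.mk x b₁) (Finset.mem_singleton_self _))) :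
      Typed T {⟨f, b₁, b₂⟩} {BVar.mk x b₁} P (.app ⟨f, b₁, b₂⟩ (BVar.mk x b₁)) (.base b₂ Q)
  | caseSum {T : FAnn} {S : Finset FVar} {Γ : Finset BVar} {e₁ e₂ : Tm} {B : ATy}
      (x y₁ y₂ : ℕ) (b₁ b₂ : Ty)
      (hx : BVar.mk x (.sum b₁ b₂) ∉ Γ) (hy₁ : BVar.mk y₁ b₁ ∉ Γ) (hy₂ : BVar.mk y₂ b₂ ∉ Γ)
      (P : CAnn (insert (BVar.mk x (.sum b₁ b₂)) Γ))
      (P₁ : CAnn (insert (BVar.mk y₁ b₁) Γ)) (P₂ : CAnn (insert (BVar.mk y₂ b₂) Γ))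
      (hP₁ : ∀ (γ : CIdx Γ) (i : Idx b₁),
        slice (BVar.mk y₁ b₁) P₁ γ i = slice (BVar.mk x (.sum b₁ b₂)) P γ (Sum.inl i))
      (hP₂ : ∀ (γ : CIdx Γ) (i : Idx b₂),
        slice (BVar.mk y₂ b₂) P₂ γ i = slice (BVar.mk x (.sum b₁ b₂)) P γ (Sum.inr i))
      (h₁ : Typed T S (insert (BVar.mk y₁ b₁) Γ) P₁ e₁ B)
      (h₂ : Typed T S (insert (BVar.mk y₂ b₂) Γ) P₂ e₂ B) :
      Typed T S (insert (BVar.mk x (.sum b₁ b₂)) Γ) P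
        (.caseSum (BVar.mk x (.sum b₁ b₂)) (BVar.mk y₁ b₁) e₁ (BVar.mk y₂ b₂) e₂) B
  | caseProd {T : FAnn} {S : Finset FVar} {Γ : Finset BVar} {e : Tm} {B : ATy}
      (x x₁ x₂ : ℕ) (b₁ b₂ : Ty)
      (hx : BVar.mk x (.prod b₁ b₂) ∉ Γ) (hx₁ : BVar.mk x₁ b₁ ∉ Γ) (hx₂ : BVar.mk x₂ b₂ ∉ Γ)
      (hne : BVar.mk x₁ b₁ ≠ BVar.mk x₂ b₂)
      (P : CAnn (insert (BVar.mk x (.prod b₁ b₂)) Γ))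
      (P₁ : CAnn (insert (BVar.mk x₁ b₁) (insert (BVar.mk x₂ b₂) Γ)))
      (hP₁ : ∀ (γ : CIdx Γ) (i₁ : Idx b₁) (i₂ : Idx b₂),
        slice (BVar.mk x₁ b₁) P₁ (γ.ext (BVar.mk x₂ b₂) i₂) i₁ = slice (BVar.mk x (.prod b₁ b₂)) P
          γ (i₁, i₂))
      (h : Typed T S (insert (BVar.mk x₁ b₁) (insert (BVar.mk x₂ b₂) Γ)) P₁ e B) :
      Typed T S (insert (BVar.mk x (.prod b₁ b₂)) Γ) P
        (.casePair (BVar.mk x (.prod b₁ b₂)) (BVar.mk x₁ b₁) (BVar.mk x₂ b₂) e) B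
  | caseList {T : FAnn} {S : Finset FVar} {Γ : Finset BVar} {e₀ e₁ : Tm} {B : ATy}
      (x y ys : ℕ) (b : Ty)
      (hx : BVar.mk x (.list b) ∉ Γ) (hy : BVar.mk y b ∉ Γ) (hys : BVar.mk ys (.list b) ∉ Γ)
      (P : CAnn (insert (BVar.mk x (.list b)) Γ)) (P₀ : CAnn Γ)
      (P₁ : CAnn (insert (BVar.mk y b) (insert (BVar.mk ys (.list b)) Γ)))
      (hP₀ : ∀ γ : CIdx Γ, P₀ γ = slice (BVar.mk x (.list b)) P γ (nilIdx b))
      (hP₁ : ∀ (γ : CIdx Γ) (j : Idx b) (k : Idx (.list b)),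
        slice (BVar.mk y b) P₁ (γ.ext (BVar.mk ys (.list b)) k) j = shift
          (slice (BVar.mk x (.list b)) P γ) j k)
      (h₀ : Typed T S Γ P₀ e₀ B)
      (h₁ : Typed T S (insert (BVar.mk y b) (insert (BVar.mk ys (.list b)) Γ)) P₁ e₁ B) :
      Typed T S (insert (BVar.mk x (.list b)) Γ) P
        (.caseList (BVar.mk x (.list b)) e₀ (BVar.mk y b) (BVar.mk ys (.list b)) e₁) B
  | letBase {T : FAnn} {S₁ S₂ : Finset FVar} {Γ₁ Γ₂ : Finset BVar} {e₁ e₂ : Tm} {B : ATy}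
      (x : BVar) (hS : Disjoint S₁ S₂) (hΓ : Disjoint Γ₁ Γ₂) (hx : x ∉ Γ₂)
      (P : CAnn (Γ₁ ∪ Γ₂)) (R : CAnn (insert x Γ₂))
      (P₁ : CIdx Γ₂ → CAnn Γ₁) (R₁ : CIdx Γ₂ → Ann x.ty)
      (hP₁ : ∀ (j : CIdx Γ₂) (i : CIdx Γ₁), P₁ j i = P (i.join j))
      (hR₁ : ∀ (j : CIdx Γ₂) (k : Idx x.ty), R₁ j k = slice x R j k)
      (h₁ : ∀ j : CIdx Γ₂, Typed T S₁ Γ₁ (P₁ j) e₁ (.base x.ty (R₁ j)))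
      (h₂ : Typed T S₂ (insert x Γ₂) R e₂ B) :
      Typed T (S₁ ∪ S₂) (Γ₁ ∪ Γ₂) P (.letBase x e₁ e₂) B
  | letArrow {T : FAnn} {S₁ S₂ : Finset FVar} {Γ : Finset BVar} {e₁ e₂ : Tm} {B : ATy}
      (f : FVar) (hS : Disjoint S₁ S₂) (hf : f ∉ S₂) (P : CAnn Γ)
      (A : Set (Ann f.dom × Ann f.cod))
      (h₁ : ∀ a ∈ A, Typed T S₁ ∅ 0 e₁ (.arrow f.dom f.cod a.1 a.2))
      (h₂ : Typed (Function.update T f A) (insert f S₂) Γ P e₂ B) :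
      Typed T (S₁ ∪ S₂) Γ P (.letArrow f e₁ e₂) B
  | shareBase {T : FAnn} {S : Finset FVar} {Γ : Finset BVar} {e : Tm} {B : ATy}
      (x x₁ x₂ : ℕ) (b : Ty)
      (hx : BVar.mk x b ∉ Γ) (hx₁ : BVar.mk x₁ b ∉ Γ) (hx₂ : BVar.mk x₂ b ∉ Γ) (hne : x₁ ≠ x₂)
      (P : CAnn (insert (BVar.mk x b) Γ))
        (P₁ : CAnn (insert (BVar.mk x₁ b) (insert (BVar.mk x₂ b) Γ)))
      (hP₁ : ∀ (γ : CIdx Γ) (v : Val b),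
        potential (slice (BVar.mk x b) P γ) v =
          potential₂ (fun k₁ k₂ : Idx b => slice (BVar.mk x₁ b) P₁ (γ.ext (BVar.mk x₂ b) k₂) k₁) v)
      (h : Typed T S (insert (BVar.mk x₁ b) (insert (BVar.mk x₂ b) Γ)) P₁ e B) :
      Typed T S (insert (BVar.mk x b) Γ) P
        (.shareBase (BVar.mk x b) (BVar.mk x₁ b) (BVar.mk x₂ b) e) B
  | shareArrow {T : FAnn} {S : Finset FVar} {Γ : Finset BVar} {e : Tm} {B : ATy}
      (f f₁ f₂ : ℕ) (b₁ b₂ : Ty)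
      (hf : ⟨f, b₁, b₂⟩ ∉ S) (hf₁ : ⟨f₁, b₁, b₂⟩ ∉ S) (hf₂ : ⟨f₂, b₁, b₂⟩ ∉ S) (hne : f₁ ≠ f₂)
      (P : CAnn Γ)
      (h : Typed (Function.update (Function.update T ⟨f₁, b₁, b₂⟩ (T ⟨f, b₁, b₂⟩))
          ⟨f₂, b₁, b₂⟩ (T ⟨f, b₁, b₂⟩))
        (insert ⟨f₁, b₁, b₂⟩ (insert ⟨f₂, b₁, b₂⟩ S)) Γ P e B) :
      Typed T (insert ⟨f, b₁, b₂⟩ S) Γ P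
        (.shareArrow ⟨f, b₁, b₂⟩ ⟨f₁, b₁, b₂⟩ ⟨f₂, b₁, b₂⟩ e) B
  | primrec {T : FAnn} {S : Finset FVar} {Γ : Finset BVar} {e₀ e₁ : Tm}
      (x y ys z : ℕ) (b b₂ : Ty) (hx : BVar.mk x (.list b) ∉ Γ)
      (hzy : BVar.mk z b₂ ≠ BVar.mk y b) (hzys : BVar.mk z b₂ ≠ BVar.mk ys (.list b))
      (P : CAnn (insert (BVar.mk x (.list b)) Γ)) (Q : Ann b₂)
      (P₀ : CAnn Γ) (P₁ : CAnn (ctx₃ (BVar.mk y b) (BVar.mk ys (.list b)) (BVar.mk z b₂)))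
      (P' : Idx b × Idx (.list b) →₀ CAnn (insert (BVar.mk x (.list b)) Γ))
      (Q' : Idx b × Idx (.list b) →₀ Ann b₂)
      (hP₀ : ∀ γ : CIdx Γ, P₀ γ = slice (BVar.mk x (.list b)) P γ (nilIdx b))
      (hshare : ∀ (γ : CIdx Γ) (j : Idx b) (v : Val (.list b)),
        potential (shift (slice (BVar.mk x (.list b)) P γ) j) v =
          potential₂ (fun k₁ k₂ : Idx (.list b) =>
            callCoeff (slice (BVar.mk x (.list b)) P γ)
              (slice (BVar.mk x (.list b)) (P' (j, k₂)) γ) j k₂ k₁) v)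
      (hP₁ : ∀ (j : Idx b) (l : Idx (.list b)) (k : Idx b₂),
        P₁ (idx₃ (BVar.mk y b) (BVar.mk ys (.list b)) (BVar.mk z b₂) j l k) = callCoeff Q
          (Q' (j, l)) j l k)
      (hdeg : ∀ j k, Q' j k ≠ 0 → ∃ k', Q k' ≠ 0 ∧ deg b₂ k < deg b₂ k')
      (hcall : ∀ j, (P' j ≠ 0 ∨ Q' j ≠ 0) →
        Typed T S (insert (BVar.mk x (.list b)) Γ) (P' j)
          (.primrec (BVar.mk x (.list b)) e₀ (BVar.mk y b) (BVar.mk ys (.list b)) (BVar.mk z b₂)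
            e₁) (.base b₂ (Q' j)))
      (h₀ : Typed T S Γ P₀ e₀ (.base b₂ Q))
      (h₁ : Typed T ∅ (ctx₃ (BVar.mk y b) (BVar.mk ys (.list b)) (BVar.mk z b₂)) P₁ e₁
        (.base b₂ Q)) :
      Typed T S (insert (BVar.mk x (.list b)) Γ) P
        (.primrec (BVar.mk x (.list b)) e₀ (BVar.mk y b) (BVar.mk ys (.list b)) (BVar.mk z b₂) e₁)
          (.base b₂ Q)
  | sub {T : FAnn} {S : Finset FVar} {Γ : Finset BVar} {e : Tm} {b : Ty} (P : CAnn Γ)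
      (Q₁ Q₂ : Ann b) (hQ : Q₂ ≤ Q₁) (h : Typed T S Γ P e (.base b Q₁)) :
      Typed T S Γ P e (.base b Q₂)
  | sup {T : FAnn} {S : Finset FVar} {Γ : Finset BVar} {e : Tm} {B : ATy}
      (P₁ P₂ : CAnn Γ) (hP : P₁ ≤ P₂) (h : Typed T S Γ P₁ e B) :
      Typed T S Γ P₂ e B
  | weak {T : FAnn} {S₁ S₂ : Finset FVar} {Γ₁ Γ₂ : Finset BVar} {e : Tm} {B : ATy}
      (hS : S₁ ⊆ S₂) (hΓ : Γ₁ ⊆ Γ₂) (P₁ : CAnn Γ₁) (P₂ : CAnn Γ₂)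
      (hP : ∀ γ : CIdx Γ₂, γ.ZeroOff Γ₁ → P₁ (γ.restrict hΓ) = P₂ γ)
      (h : Typed T S₁ Γ₁ P₁ e B) :
      Typed T S₂ Γ₂ P₂ e B
  | relax {T : FAnn} {S : Finset FVar} {Γ : Finset BVar} {e : Tm} {b : Ty} (c : NNRat)
      (P₁ P₂ : CAnn Γ) (Q₁ Q₂ : Ann b)
      (hP : ∀ γ : CIdx Γ, P₂ γ = P₁ γ + constCoeff (γ.ZeroOff ∅) c)
      (hQ : ∀ i : Idx b, Q₂ i = Q₁ i + constCoeff (deg b i = 0) c)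
      (h : Typed T S Γ P₁ e (.base b Q₁)) :
      Typed T S Γ P₂ e (.base b Q₂)

/-- The set `A` of annotated arrow types `⟨b₁, P⟩ → ⟨b₂, Q⟩` fits the time class `t`: every
uniform output annotation `Q` is available, with an input annotation `P` that is again
`uniform(d, n)` if `t` is `const` (and also if `d = 0`, i.e. constant potential in the output
takes only constant potential in the input). -/
def Fits {b₁ b₂ : Ty} (A : Set (Ann b₁ × Ann b₂)) (t : Time) : Prop :=
  ∀ (d n : ℕ) (Q : Ann b₂), Uniform Q d n →
    ∃ P : Ann b₁, (P, Q) ∈ A ∧ (t = .const ∨ d = 0 → Uniform P d n)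

end RaML

end

/-!
The proof is an induction on the derivation of `inhpoly`, with an invariant that is stronger than
uniformity in one respect and weaker in another.

Stronger: uniformity bounds the degree in each variable outside `V` separately, which does not
survive matching on a pair, where the degrees of the components add up. The invariant
`CBound P d n V` bounds the *joint* degree in the variables outside `V` by `d`, and lets it be attained only where
all variables in `V` have degree zero. This condition is compatible with all rules. In a `let`, an
index of `Γ₂` uses up a part of the degree `d`, and what remains bounds the annotation at which the
bound term has to be typed. For `d = 0` the set `V` no longer matters, and the invariant says that a
constant output costs a constant input.

Weaker: coefficients of degree `d` need only be at most `n`. Since annotations of contexts may be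
raised and those of results lowered, equality can be restored at any time
(`CBound.exists_cUniform`, `Bound.exists_uniform`). As the bounds of an annotation have a
lexicographically least pair (`exists_least_bound`), the context annotation `P` can be chosen for
`Q` once and for all, so that *every* bound of `Q` holds for `P`; this is `Controlled`.

Three rules need an idea of their own.

* Sharing needs the product of two base polynomials to be a sum of base polynomials
  (`exists_expands`). For lists this is the quasi-shuffle product. Base polynomials of degree zero
  are orthogonal idempotents, so the constant part keeps its bound (`exists_linearization`).
* Matching on a list outside `V` cannot charge the coefficient of head and tail `(j, k)` to the
  index `j :: k`, whose degree is too large by one. It can charge it to `k` if `j` has degree zero,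
  and this is always so when the elements contain no list (`Controlled.caseList`).
* For primitive recursion, induction on the degree `d` of the output annotation `Q` provides the
  calls of lower degree. By the bound for the step term, its demand on the recursive result has
  degree `d` only at the zero index of head and tail, where it is at most `n`; there the uniform
  annotation `Q` itself suffices. All of the remaining demand has degree below `d`, is met by
  recursive calls of lower degree, and is paid for by the coefficients at nonempty list
  indexes (`Controlled.primrec_step`).
-/

namespace RaML

/-! ### Indexes of bounded degree -/

theorem deg_nilIdx (b : Ty) : deg (.list b) (nilIdx b) = 0 := rfl

theorem deg_consIdx {b : Ty} (j : Idx b) (k : Idx (.list b)) :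
    deg (.list b) (consIdx j k) = deg b j + deg (.list b) k + 1 := by
  have h : ∀ l : List (Idx b), (j :: l).length + ((j :: l).map (deg b)).sum =
      deg b j + (l.length + (l.map (deg b)).sum) + 1 := fun l => by
    simp only [List.length_cons, List.map_cons, List.sum_cons]
    omega
  exact h k

/-- Case distinction on an index of a list type, in terms of `nilIdx` and `consIdx`. -/
theorem idxList_cases {b : Ty} {p : Idx (.list b) → Prop} (hnil : p (nilIdx b))
    (hcons : ∀ j k, p (consIdx j k)) (k : Idx (.list b)) : p k := by
  change List (Idx b) at k
  cases k with
  | nil => exact hnil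
  | cons j k => exact hcons j k

theorem deg_list_eq_zero {b : Ty} (k : Idx (.list b)) : deg (.list b) k = 0 ↔ k = nilIdx b := by
  induction k using idxList_cases with
  | hnil => simp [deg_nilIdx]
  | hcons j k =>
    have h : consIdx j k ≠ nilIdx b := List.cons_ne_nil j k
    simp [deg_consIdx, h]

theorem deg_eq_zero_of_listFree {b : Ty} (hb : b.ListFree) (i : Idx b) : deg b i = 0 := by
  induction b with
  | unit => rfl
  | sum a b iha ihb =>
    rcases i with i | i
    · exact iha hb.1 i
    · exact ihb hb.2 i
  | prod a b iha ihb =>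
    have h₁ := iha hb.1 (Prod.fst i)
    have h₂ := ihb hb.2 (Prod.snd i)
    change deg a (Prod.fst i) + deg b (Prod.snd i) = 0
    omega
  | list b _ => exact hb.elim

theorem finite_deg_le (b : Ty) (N : ℕ) : {i : Idx b | deg b i ≤ N}.Finite := by
  induction b generalizing N with
  | unit => exact Set.toFinite (α := Unit) _
  | sum a b iha ihb =>
    refine (((iha N).image Sum.inl).union ((ihb N).image Sum.inr)).subset ?_
    rintro (i | i) hi
    · exact Or.inl ⟨i, hi, rfl⟩
    · exact Or.inr ⟨i, hi, rfl⟩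
  | prod a b iha ihb =>
    refine ((iha N).prod (ihb N)).subset ?_
    rintro ⟨i, j⟩ hij
    have h : deg a i + deg b j ≤ N := hij
    exact ⟨show deg a i ≤ N by omega, show deg b j ≤ N by omega⟩
  | list b ih =>
    induction N with
    | zero =>
      refine (Set.finite_singleton (nilIdx b)).subset fun k hk => ?_
      exact (deg_list_eq_zero k).1 (Nat.le_zero.1 hk)
    | succ N ihN =>
      refine ((Set.finite_singleton (nilIdx b)).union
        (Set.Finite.image2 consIdx (ih (N + 1)) ihN)).subset fun k => ?_
      induction k using idxList_cases with
      | hnil => exact fun _ => Or.inl rfl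
      | hcons j k =>
        intro hk
        have h : deg b j + deg (.list b) k + 1 ≤ N + 1 := deg_consIdx j k ▸ hk
        exact Or.inr ⟨j, show deg b j ≤ N + 1 by omega, k, show deg (.list b) k ≤ N by omega, rfl⟩

/-- A family indexed by `Idx b` whose support has bounded degree is finitely supported. -/
theorem exists_finsupp_of_deg_le {b : Ty} {M : Type*} [Zero M] (f : Idx b → M) (N : ℕ)
    (hf : ∀ i, f i ≠ 0 → deg b i ≤ N) : ∃ Q : Idx b →₀ M, ∀ i, Q i = f i :=
  ⟨Finsupp.ofSupportFinite f ((finite_deg_le b N).subset fun _ hi => hf _ hi), fun _ => rfl⟩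

theorem exists_deg_le {b : Ty} {M : Type*} [Zero M] (Q : Idx b →₀ M) :
    ∃ N, ∀ i, Q i ≠ 0 → deg b i ≤ N :=
  ⟨Q.support.sup (deg b), fun _ hi => Finset.le_sup (f := deg b) (Finsupp.mem_support_iff.2 hi)⟩

/-! ### Degrees of context indexes -/

/-- The total degree of a context index on the variables outside `V`. -/
def outDeg {Γ : Finset BVar} (V : Finset BVar) (γ : CIdx Γ) : ℕ :=
  ∑ z ∈ Γ, if h : z ∈ Γ then (if z ∈ V then 0 else deg z.ty (γ z h)) else 0

theorem outDeg_anti {Γ V V' : Finset BVar} (γ : CIdx Γ) (h : ∀ z ∈ Γ, z ∈ V → z ∈ V') :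
    outDeg V' γ ≤ outDeg V γ := by
  refine Finset.sum_le_sum fun z hz => ?_
  by_cases hV : z ∈ V
  · simp [hV, h z hz hV]
  · rw [dif_pos hz, dif_pos hz, if_neg hV]
    split_ifs <;> simp

theorem outDeg_congr {Γ V V' : Finset BVar} (γ : CIdx Γ) (h : ∀ z ∈ Γ, z ∈ V ↔ z ∈ V') :
    outDeg V γ = outDeg V' γ :=
  le_antisymm (outDeg_anti γ fun z hz => (h z hz).2) (outDeg_anti γ fun z hz => (h z hz).1)

theorem outDeg_le_total {Γ : Finset BVar} (V : Finset BVar) (γ : CIdx Γ) :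
    outDeg V γ ≤ outDeg ∅ γ :=
  outDeg_anti γ (by simp)

theorem deg_le_outDeg {Γ V : Finset BVar} (γ : CIdx Γ) {z : BVar} (hz : z ∈ Γ) (hV : z ∉ V) :
    deg z.ty (γ z hz) ≤ outDeg V γ := by
  have h := Finset.single_le_sum (f := fun z => if h : z ∈ Γ then
    (if z ∈ V then 0 else deg z.ty (γ z h)) else 0) (fun _ _ => Nat.zero_le _) hz
  simpa [outDeg, hz, hV] using h

theorem deg_add_deg_le_outDeg {Γ V : Finset BVar} (γ : CIdx Γ) {y z : BVar} (hy : y ∈ Γ)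
    (hz : z ∈ Γ) (hne : y ≠ z) (hyV : y ∉ V) (hzV : z ∉ V) :
    deg y.ty (γ y hy) + deg z.ty (γ z hz) ≤ outDeg V γ := by
  have h := Finset.sum_le_sum_of_subset (f := fun z => if h : z ∈ Γ then
    (if z ∈ V then 0 else deg z.ty (γ z h)) else 0)
    (show ({y, z} : Finset BVar) ⊆ Γ by simp [Finset.insert_subset_iff, hy, hz])
  rw [Finset.sum_pair hne] at h
  simpa [outDeg, hy, hz, hyV, hzV] using h

theorem outDeg_eq_of_zeroOff {Γ V : Finset BVar} (γ : CIdx Γ) {v : BVar} (hv : v ∈ Γ)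
    (hV : v ∉ V) (h : γ.ZeroOff {v}) : outDeg V γ = deg v.ty (γ v hv) := by
  unfold outDeg
  rw [Finset.sum_eq_single v]
  · simp [hv, hV]
  · intro z hz hne
    simp [hz, h z hz (by simpa using hne)]
  · exact fun h => absurd hv h

theorem outDeg_restrict {Γ Γ' : Finset BVar} (V : Finset BVar) (γ : CIdx Γ) (hΓ : Γ' ⊆ Γ)
    (h : γ.ZeroOff Γ') : outDeg V (γ.restrict hΓ) = outDeg V γ := by
  unfold outDeg
  rw [← Finset.sum_subset hΓ]
  · refine Finset.sum_congr rfl fun z hz => ?_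
    rw [dif_pos hz, dif_pos (hΓ hz)]
    rfl
  · intro z hz hz'
    simp [hz, h z hz hz']

theorem CIdx.ext_self {Γ : Finset BVar} (γ : CIdx Γ) (x : BVar) (k : Idx x.ty)
    (h : x ∈ insert x Γ) : γ.ext x k x h = k := by
  simp [CIdx.ext]

theorem CIdx.ext_of_ne {Γ : Finset BVar} (γ : CIdx Γ) (x : BVar) (k : Idx x.ty) {z : BVar}
    (h : z ∈ insert x Γ) (hne : z ≠ x) :
    γ.ext x k z h = γ z (Finset.mem_of_mem_insert_of_ne h hne) := by
  simp [CIdx.ext, hne]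

theorem CIdx.restrict_ext {Γ : Finset BVar} (γ : CIdx Γ) {x : BVar} (hx : x ∉ Γ) (k : Idx x.ty) :
    (γ.ext x k).restrict (Finset.subset_insert x Γ) = γ := by
  funext z hz
  exact CIdx.ext_of_ne γ x k _ fun h => hx (h ▸ hz)

theorem CIdx.ext_restrict {Γ : Finset BVar} {x : BVar} (ψ : CIdx (insert x Γ)) :
    (ψ.restrict (Finset.subset_insert x Γ)).ext x (ψ x (Finset.mem_insert_self x Γ)) = ψ := by
  funext z hz
  by_cases h : z = x
  · subst h
    exact CIdx.ext_self _ _ _ _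
  · exact CIdx.ext_of_ne _ _ _ _ h

/-- An index of `Γ, x` is a pair of an index of `Γ` and an index of the type of `x`. -/
theorem CIdx.ext_cases {Γ : Finset BVar} {x : BVar} {p : CIdx (insert x Γ) → Prop}
    (h : ∀ (γ : CIdx Γ) (k : Idx x.ty), p (γ.ext x k)) (ψ : CIdx (insert x Γ)) : p ψ :=
  CIdx.ext_restrict ψ ▸ h _ _

theorem outDeg_ext {Γ V : Finset BVar} (γ : CIdx Γ) {x : BVar} (hx : x ∉ Γ) (k : Idx x.ty) :
    outDeg V (γ.ext x k) = (if x ∈ V then 0 else deg x.ty k) + outDeg V γ := by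
  unfold outDeg
  rw [Finset.sum_insert hx, dif_pos (Finset.mem_insert_self x Γ), CIdx.ext_self]
  congr 1
  refine Finset.sum_congr rfl fun z hz => ?_
  have hne : z ≠ x := fun h => hx (h ▸ hz)
  rw [dif_pos (Finset.mem_insert_of_mem hz), dif_pos hz, CIdx.ext_of_ne _ _ _ _ hne]

theorem outDeg_ext_of_mem {Γ V : Finset BVar} (γ : CIdx Γ) {x : BVar} (hx : x ∉ Γ) (k : Idx x.ty)
    (hV : x ∈ V) : outDeg V (γ.ext x k) = outDeg V γ := by
  rw [outDeg_ext γ hx, if_pos hV, zero_add]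

theorem outDeg_ext_of_notMem {Γ V : Finset BVar} (γ : CIdx Γ) {x : BVar} (hx : x ∉ Γ)
    (k : Idx x.ty) (hV : x ∉ V) : outDeg V (γ.ext x k) = deg x.ty k + outDeg V γ := by
  rw [outDeg_ext γ hx, if_neg hV]

theorem total_ext {Γ : Finset BVar} (γ : CIdx Γ) {x : BVar} (hx : x ∉ Γ) (k : Idx x.ty) :
    outDeg ∅ (γ.ext x k) = deg x.ty k + outDeg ∅ γ :=
  outDeg_ext_of_notMem γ hx k (by simp)

theorem outDeg_singleton {V : Finset BVar} {x : BVar} (γ : CIdx {x}) :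
    outDeg V γ = if x ∈ V then 0 else deg x.ty (γ x (Finset.mem_singleton_self x)) := by
  simp [outDeg]

theorem outDeg_pair {V : Finset BVar} {x y : BVar} (hne : x ≠ y) (γ : CIdx {x, y}) :
    outDeg V γ = (if x ∈ V then 0 else deg x.ty (γ x (by simp))) +
      (if y ∈ V then 0 else deg y.ty (γ y (by simp))) := by
  simp [outDeg, Finset.sum_pair hne]

theorem CIdx.join_left {Γ₁ Γ₂ : Finset BVar} (i : CIdx Γ₁) (j : CIdx Γ₂) :
    (i.join j).restrict Finset.subset_union_left = i := by
  funext z hz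
  simp [CIdx.restrict, CIdx.join, hz]

theorem CIdx.join_right {Γ₁ Γ₂ : Finset BVar} (hΓ : Disjoint Γ₁ Γ₂) (i : CIdx Γ₁) (j : CIdx Γ₂) :
    (i.join j).restrict Finset.subset_union_right = j := by
  funext z hz
  simp [CIdx.restrict, CIdx.join, Finset.disjoint_right.1 hΓ hz]

/-- An index of `Γ₁ ∪ Γ₂` is a pair of an index of `Γ₁` and an index of `Γ₂`. -/
theorem CIdx.join_cases {Γ₁ Γ₂ : Finset BVar} {p : CIdx (Γ₁ ∪ Γ₂) → Prop}
    (h : ∀ (i : CIdx Γ₁) (j : CIdx Γ₂), p (i.join j)) (ψ : CIdx (Γ₁ ∪ Γ₂)) : p ψ := by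
  have hψ : (ψ.restrict Finset.subset_union_left).join (ψ.restrict Finset.subset_union_right) =
      ψ := by
    funext z hz
    unfold CIdx.join
    split_ifs <;> rfl
  exact hψ ▸ h _ _

theorem outDeg_join {Γ₁ Γ₂ V : Finset BVar} (hΓ : Disjoint Γ₁ Γ₂) (i : CIdx Γ₁) (j : CIdx Γ₂) :
    outDeg V (i.join j) = outDeg V i + outDeg V j := by
  unfold outDeg
  rw [Finset.sum_union hΓ]
  congr 1
  · refine Finset.sum_congr rfl fun z hz => ?_
    rw [dif_pos (Finset.mem_union_left _ hz), dif_pos hz]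
    simp [CIdx.join, hz]
  · refine Finset.sum_congr rfl fun z hz => ?_
    rw [dif_pos (Finset.mem_union_right _ hz), dif_pos hz]
    simp [CIdx.join, Finset.disjoint_right.1 hΓ hz]

theorem finite_total_le (Γ : Finset BVar) (N : ℕ) : {γ : CIdx Γ | outDeg ∅ γ ≤ N}.Finite := by
  have hfin : (Set.univ.pi fun z : Γ => {i : Idx z.1.ty | deg z.1.ty i ≤ N}).Finite :=
    Set.Finite.pi fun z => finite_deg_le z.1.ty N
  let e : CIdx Γ → ∀ z : Γ, Idx z.1.ty := fun γ z => γ z.1 z.2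
  have he : Function.Injective e := fun γ γ' h => by
    funext z hz
    exact congrFun h ⟨z, hz⟩
  refine (hfin.preimage he.injOn).subset fun γ hγ z _ => ?_
  exact (deg_le_outDeg γ z.2 (by simp)).trans hγ

theorem exists_cAnn_of_total_le {Γ : Finset BVar} (f : CIdx Γ → NNRat) (N : ℕ)
    (hf : ∀ γ, f γ ≠ 0 → outDeg ∅ γ ≤ N) : ∃ P : CAnn Γ, ∀ γ, P γ = f γ :=
  ⟨Finsupp.ofSupportFinite f ((finite_total_le Γ N).subset fun _ hi => hf _ hi), fun _ => rfl⟩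

theorem exists_total_le {Γ : Finset BVar} (P : CAnn Γ) : ∃ N, ∀ γ, P γ ≠ 0 → outDeg ∅ γ ≤ N :=
  ⟨P.support.sup (outDeg ∅),
    fun _ hi => Finset.le_sup (f := outDeg ∅) (Finsupp.mem_support_iff.2 hi)⟩

/-- An annotation of `Γ, x` may be given by its coefficients at the pairs `(γ, k)`. -/
theorem exists_cAnn_insert {Γ : Finset BVar} {x : BVar} (hx : x ∉ Γ)
    (f : CIdx Γ → Idx x.ty → NNRat) (N : ℕ)
    (hf : ∀ γ k, f γ k ≠ 0 → deg x.ty k + outDeg ∅ γ ≤ N) :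
    ∃ P : CAnn (insert x Γ), ∀ γ k, P (γ.ext x k) = f γ k := by
  obtain ⟨P, hP⟩ := exists_cAnn_of_total_le (Γ := insert x Γ)
    (fun ψ => f (ψ.restrict (Finset.subset_insert x Γ)) (ψ x (Finset.mem_insert_self x Γ))) N
    (fun ψ => by
      induction ψ using CIdx.ext_cases with
      | h γ k =>
        rw [CIdx.restrict_ext γ hx, CIdx.ext_self, total_ext γ hx]
        exact hf γ k)
  refine ⟨P, fun γ k => ?_⟩
  rw [hP, CIdx.restrict_ext γ hx, CIdx.ext_self]

/-- The coefficients `P (γ, ·)` as an annotation of the type of `x`. -/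
theorem exists_ann_slice {Γ : Finset BVar} {x : BVar} (hx : x ∉ Γ) (P : CAnn (insert x Γ))
    (γ : CIdx Γ) : ∃ Q : Ann x.ty, ∀ k, Q k = P (γ.ext x k) := by
  obtain ⟨N, hN⟩ := exists_total_le P
  refine exists_finsupp_of_deg_le _ N fun k hk => ?_
  have h := hN _ hk
  rw [total_ext γ hx] at h
  omega

/-! ### Degree bounds for annotations -/

/-- `Q` has degree at most `d`, and its coefficients of degree `d` are at most `n`. -/
def Bound {b : Ty} (Q : Ann b) (d n : ℕ) : Prop :=
  ∀ i, Q i ≠ 0 → deg b i < d ∨ (deg b i ≤ d ∧ Q i ≤ n)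

/-- `P` has joint degree at most `d` in the variables outside `V`. A nonzero coefficient whose
joint degree is exactly `d` is at most `n`, and its index has degree zero on `V`. For `d = 0` the
set `V` is irrelevant: `P` is then at most the constant `n`. -/
def CBound {Γ : Finset BVar} (P : CAnn Γ) (d n : ℕ) (V : Finset BVar) : Prop :=
  ∀ γ, P γ ≠ 0 → outDeg V γ < d ∨ (outDeg ∅ γ ≤ d ∧ P γ ≤ n)

theorem Bound.deg_le {b : Ty} {Q : Ann b} {d n : ℕ} (h : Bound Q d n) (i : Idx b) (hi : Q i ≠ 0) :
    deg b i ≤ d := by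
  rcases h i hi with h | h
  · exact h.le
  · exact h.1

theorem CBound.outDeg_le {Γ : Finset BVar} {P : CAnn Γ} {d n : ℕ} {V : Finset BVar}
    (h : CBound P d n V) (γ : CIdx Γ) (hγ : P γ ≠ 0) : outDeg V γ ≤ d := by
  rcases h γ hγ with h | h
  · exact h.le
  · exact (outDeg_le_total V γ).trans h.1

theorem CBound.mono {Γ : Finset BVar} {P : CAnn Γ} {d n d' n' : ℕ} {V : Finset BVar}
    (h : CBound P d n V) (hdn : d < d' ∨ (d = d' ∧ n ≤ n')) : CBound P d' n' V := by
  intro γ hγ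
  rcases hdn with hd | ⟨rfl, hn⟩
  · exact Or.inl ((h.outDeg_le γ hγ).trans_lt hd)
  · refine (h γ hγ).imp_right fun h => ⟨h.1, h.2.trans ?_⟩
    exact_mod_cast hn

theorem Bound.mono {b : Ty} {Q : Ann b} {d n d' n' : ℕ}
    (h : Bound Q d n) (hdn : d < d' ∨ (d = d' ∧ n ≤ n')) : Bound Q d' n' := by
  intro i hi
  rcases hdn with hd | ⟨rfl, hn⟩
  · exact Or.inl ((h.deg_le i hi).trans_lt hd)
  · refine (h i hi).imp_right fun h => ⟨h.1, h.2.trans ?_⟩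
    exact_mod_cast hn

theorem exists_bound_of_deg_le {b : Ty} (Q : Ann b) (d : ℕ) (h : ∀ i, Q i ≠ 0 → deg b i ≤ d) :
    ∃ n, Bound Q d n := by
  obtain ⟨n, hn⟩ := exists_nat_ge (Q.support.sup Q)
  exact ⟨n, fun i hi => Or.inr ⟨h i hi, (Finset.le_sup (Finsupp.mem_support_iff.2 hi)).trans hn⟩⟩

/-- Among the bounds of an annotation there is a lexicographically least one. -/
theorem exists_least_bound {b : Ty} (Q : Ann b) :
    ∃ d n, Bound Q d n ∧ ∀ d' n', Bound Q d' n' → d < d' ∨ (d = d' ∧ n ≤ n') := by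
  classical
  have hd : ∃ d, ∃ n, Bound Q d n := by
    obtain ⟨d, hd⟩ := exists_deg_le Q
    exact ⟨d, exists_bound_of_deg_le Q d hd⟩
  have hn := Nat.find_spec hd
  refine ⟨Nat.find hd, Nat.find hn, Nat.find_spec hn, fun d' n' h => ?_⟩
  rcases (Nat.find_min' hd ⟨n', h⟩).lt_or_eq with hlt | heq
  · exact Or.inl hlt
  · exact Or.inr ⟨heq, Nat.find_min' hn (heq ▸ h)⟩

theorem bound_zero {b : Ty} : Bound (0 : Ann b) 0 0 := fun _ hi => absurd Finsupp.zero_apply hi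

theorem eq_zero_of_cBound_zero {Γ V : Finset BVar} {P : CAnn Γ} (h : CBound P 0 0 V) : P = 0 := by
  ext γ
  by_contra hγ
  rcases h γ (by simpa using hγ) with h | h
  · exact absurd h (Nat.not_lt_zero _)
  · exact hγ (by simpa using h.2)

theorem Uniform.bound {b : Ty} {Q : Ann b} {d n : ℕ} (h : Uniform Q d n) : Bound Q d n := by
  intro i hi
  rcases (h.1 i hi).lt_or_eq with hlt | heq
  · exact Or.inl hlt
  · exact Or.inr ⟨heq.le, (h.2 i heq).le⟩

theorem Bound.exists_uniform {b : Ty} {Q : Ann b} {d n : ℕ} (h : Bound Q d n) :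
    ∃ Q', Q ≤ Q' ∧ Uniform Q' d n := by
  classical
  obtain ⟨Q', hQ'⟩ := exists_finsupp_of_deg_le (fun i => if deg b i = d then (n : NNRat) else Q i) d
    (fun i hi => by
      by_cases hd : deg b i = d
      · exact hd.le
      · rw [if_neg hd] at hi
        exact h.deg_le i hi)
  refine ⟨Q', fun i => ?_, fun i hi => ?_, fun i hi => ?_⟩
  · rw [hQ']
    split_ifs with hd
    · by_cases hi : Q i = 0
      · simp [hi]
      · rcases h i hi with h | h
        · omega
        · exact h.2
    · exact le_rfl
  · rw [hQ'] at hi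
    by_cases hd : deg b i = d
    · exact hd.le
    · rw [if_neg hd] at hi
      exact h.deg_le i hi
  · rw [hQ', if_pos hi]

/-- A bounded annotation of a context becomes uniform when its coefficients of degree `d` in a
single variable outside `V` are raised to `n`. -/
theorem CBound.exists_cUniform {Γ V : Finset BVar} {P : CAnn Γ} {d n : ℕ} (h : CBound P d n V) :
    ∃ P', P ≤ P' ∧ CUniform P' d n V := by
  classical
  let A : CIdx Γ → Prop := fun γ =>
    ∃ (v : BVar) (hv : v ∈ Γ), v ∉ V ∧ deg v.ty (γ v hv) = d ∧ γ.ZeroOff {v}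
  obtain ⟨N, hN⟩ := exists_total_le P
  obtain ⟨P', hP'⟩ := exists_cAnn_of_total_le (fun γ => if A γ then (n : NNRat) else P γ)
    (max N d) (fun γ hγ => by
      by_cases hA : A γ
      · obtain ⟨v, hv, -, hd, h0⟩ := hA
        rw [outDeg_eq_of_zeroOff γ hv (by simp) h0, hd]
        exact le_max_right _ _
      · rw [if_neg hA] at hγ
        exact (hN γ hγ).trans (le_max_left _ _))
  refine ⟨P', fun γ => ?_, fun v hv hvV => ⟨fun γ hd => ?_, fun γ hd h0 => ?_, fun γ hd h0 => ?_⟩⟩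
  · rw [hP']
    split_ifs with hA
    · obtain ⟨v, hv, hV, hd, h0⟩ := hA
      by_cases hγ : P γ = 0
      · simp [hγ]
      · rcases h γ hγ with h | h
        · rw [outDeg_eq_of_zeroOff γ hv hV h0] at h
          omega
        · exact h.2
    · exact le_rfl
  · have hA : ¬ A γ := by
      rintro ⟨w, hw, -, hdw, h0⟩
      by_cases hvw : v = w
      · subst hvw
        omega
      · have := h0 v hv (by simpa using hvw)
        omega
    rw [hP', if_neg hA]
    by_contra hγ
    have h₁ := h.outDeg_le γ hγ
    have h₂ := deg_le_outDeg γ hv hvV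
    omega
  · obtain ⟨z, hz, hzv, hz0⟩ : ∃ z, ∃ hz : z ∈ Γ, z ≠ v ∧ deg z.ty (γ z hz) ≠ 0 := by
      by_contra hcon
      push Not at hcon
      exact h0 fun z hz hzv => hcon z hz (by simpa using hzv)
    have hA : ¬ A γ := by
      rintro ⟨w, hw, -, hdw, h0w⟩
      by_cases hvw : v = w
      · subst hvw
        exact h0 h0w
      · -- two different variables carry the whole degree, so `d = 0` and `γ` is zero everywhere
        have h₁ := h0w v hv (by simpa using hvw)
        have h₂ : deg z.ty (γ z hz) = 0 := by
          by_cases hzw : z = w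
          · subst hzw
            omega
          · exact h0w z hz (by simpa using hzw)
        exact hz0 h₂
    rw [hP', if_neg hA]
    by_contra hγ
    have h₂ := deg_le_outDeg γ hv hvV
    have h₃ := deg_add_deg_le_outDeg γ hv hz hzv.symm (V := ∅) (by simp) (by simp)
    rcases h γ hγ with h | h <;> omega
  · rw [hP', if_pos ⟨v, hv, hvV, hd, h0⟩]

/-! ### Products of base polynomials -/

/-- The index `inl i` of a sum type. -/
def inlIdx {a : Ty} (b : Ty) (i : Idx a) : Idx (.sum a b) := Sum.inl (α := Idx a) (β := Idx b) i

/-- The index `inr i` of a sum type. -/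
def inrIdx (a : Ty) {b : Ty} (i : Idx b) : Idx (.sum a b) := Sum.inr (α := Idx a) (β := Idx b) i

/-- The index `(i, j)` of a product type. -/
def pairIdx {a b : Ty} (i : Idx a) (j : Idx b) : Idx (.prod a b) :=
  Prod.mk (α := Idx a) (β := Idx b) i j

/-- The empty list as a semantic value. -/
def nilVal (b : Ty) : Val (.list b) := ([] : List (Val b))

/-- The list `a :: v` as a semantic value. -/
def consVal {b : Ty} (a : Val b) (v : Val (.list b)) : Val (.list b) :=
  List.cons (α := Val b) a v

theorem deg_pairIdx {a b : Ty} (i : Idx a) (j : Idx b) :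
    deg (.prod a b) (pairIdx i j) = deg a i + deg b j := rfl

theorem idxSum_cases {a b : Ty} {p : Idx (.sum a b) → Prop} (hinl : ∀ i, p (inlIdx b i))
    (hinr : ∀ i, p (inrIdx a i)) (i : Idx (.sum a b)) : p i :=
  Sum.rec hinl hinr i

theorem idxProd_cases {a b : Ty} {p : Idx (.prod a b) → Prop} (hpair : ∀ i j, p (pairIdx i j))
    (i : Idx (.prod a b)) : p i :=
  hpair i.1 i.2

theorem valList_induction {b : Ty} {p : Val (.list b) → Prop} (hnil : p (nilVal b))
    (hcons : ∀ a v, p v → p (consVal a v)) (v : Val (.list b)) : p v := by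
  change List (Val b) at v
  induction v with
  | nil => exact hnil
  | cons a v ih => exact hcons a v ih

theorem idxList_induction {b : Ty} {p : Idx (.list b) → Prop} (hnil : p (nilIdx b))
    (hcons : ∀ j k, p k → p (consIdx j k)) (k : Idx (.list b)) : p k := by
  change List (Idx b) at k
  induction k with
  | nil => exact hnil
  | cons j k ih => exact hcons j k ih

theorem basePoly_nilIdx {b : Ty} (v : Val (.list b)) : basePoly (.list b) (nilIdx b) v = 1 := by
  have h : ∀ v : List (Val b), ((v.sublistsLen (List.length ([] : List (Idx b)))).map fun w =>
    (List.zipWith (basePoly b) [] w).prod).sum = 1 := fun v => by simp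
  exact h v

theorem basePoly_consIdx_nilVal {b : Ty} (j : Idx b) (k : Idx (.list b)) :
    basePoly (.list b) (consIdx j k) (nilVal b) = 0 := by
  have h : ∀ k : List (Idx b), ((([] : List (Val b)).sublistsLen (j :: k).length).map fun w =>
    (List.zipWith (basePoly b) (j :: k) w).prod).sum = 0 := fun v => by simp
  exact h k

theorem basePoly_consIdx_consVal {b : Ty} (j : Idx b) (k : Idx (.list b)) (a : Val b)
    (v : Val (.list b)) :
    basePoly (.list b) (consIdx j k) (consVal a v) =
      basePoly (.list b) (consIdx j k) v + basePoly b j a * basePoly (.list b) k v := by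
  have h : ∀ (k : List (Idx b)) (v : List (Val b)),
      (((a :: v).sublistsLen (j :: k).length).map fun w =>
        (List.zipWith (basePoly b) (j :: k) w).prod).sum =
      ((v.sublistsLen (j :: k).length).map fun w =>
        (List.zipWith (basePoly b) (j :: k) w).prod).sum + basePoly b j a *
      ((v.sublistsLen k.length).map fun w => (List.zipWith (basePoly b) k w).prod).sum := by
    intro k v
    simp [List.sublistsLen_succ_cons, Function.comp_def, List.sum_map_mul_left]
  exact h k v

/-- The sum of the base polynomials with the indexes in a list. -/
def polySum {b : Ty} (L : List (Idx b)) (v : Val b) : ℕ := (L.map fun k => basePoly b k v).sum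

/-- `L` expands the product of two base polynomials: `p_i p_j` is the sum of the `p_k` for the
indexes `k` in `L`, which have degree at most `deg i + deg j`. Base polynomials of degree zero are
orthogonal idempotents. -/
structure Expands {b : Ty} (i j : Idx b) (L : List (Idx b)) : Prop where
  mul_eq : ∀ v, basePoly b i v * basePoly b j v = polySum L v
  deg_le : ∀ k ∈ L, deg b k ≤ deg b i + deg b j
  self : deg b i = 0 → i = j → L = [i]
  ne : deg b i = 0 → deg b j = 0 → i ≠ j → L = []

theorem polySum_nil {b : Ty} (v : Val b) : polySum ([] : List (Idx b)) v = 0 := rfl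

theorem polySum_cons {b : Ty} (i : Idx b) (L : List (Idx b)) (v : Val b) :
    polySum (i :: L) v = basePoly b i v + polySum L v := by
  simp [polySum]

theorem polySum_append {b : Ty} (L L' : List (Idx b)) (v : Val b) :
    polySum (L ++ L') v = polySum L v + polySum L' v := by
  simp [polySum]

theorem polySum_singleton {b : Ty} (i : Idx b) (v : Val b) : polySum [i] v = basePoly b i v := by
  simp [polySum]

theorem polySum_map_consIdx_nilVal {b : Ty} (j : Idx b) (L : List (Idx (.list b))) :
    polySum (L.map (consIdx j)) (nilVal b) = 0 := by
  simp [polySum, Function.comp_def, basePoly_consIdx_nilVal]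

theorem polySum_map_consIdx_consVal {b : Ty} (j : Idx b) (L : List (Idx (.list b))) (a : Val b)
    (v : Val (.list b)) :
    polySum (L.map (consIdx j)) (consVal a v) =
      polySum (L.map (consIdx j)) v + basePoly b j a * polySum L v := by
  simp [polySum, Function.comp_def, basePoly_consIdx_consVal, List.sum_map_mul_left,
    List.sum_map_add]

theorem polySum_map_of_eq {a b : Ty} (f : Idx a → Idx b) (L : List (Idx a)) (v : Val a) (w : Val b)
    (c : ℕ) (h : ∀ i, basePoly b (f i) w = c * basePoly a i v) :
    polySum (L.map f) w = c * polySum L v := by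
  simp [polySum, Function.comp_def, h, List.sum_map_mul_left]

theorem polySum_map_eq_zero {a b : Ty} (f : Idx a → Idx b) (L : List (Idx a)) (w : Val b)
    (h : ∀ i, basePoly b (f i) w = 0) : polySum (L.map f) w = 0 := by
  simp [polySum, Function.comp_def, h]

theorem Expands.inl {a b : Ty} {i j : Idx a} {L : List (Idx a)} (h : Expands i j L) :
    Expands (inlIdx b i) (inlIdx b j) (L.map (inlIdx b)) where
  mul_eq := by
    rintro (v | v)
    · exact (h.mul_eq v).trans
        ((polySum_map_of_eq (inlIdx b) L v _ 1 fun _ => (one_mul _).symm).trans (one_mul _)).symm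
    · exact (zero_mul _).trans (polySum_map_eq_zero (inlIdx b) L _ fun _ => rfl).symm
  deg_le := by
    intro k hk
    obtain ⟨k', hk', rfl⟩ := List.mem_map.1 hk
    exact h.deg_le k' hk'
  self := fun hi hij => by rw [h.self hi (Sum.inl_injective hij)]; rfl
  ne := fun hi hj hij => by rw [h.ne hi hj fun h => hij (congrArg (inlIdx b) h)]; rfl

theorem Expands.inr {a b : Ty} {i j : Idx b} {L : List (Idx b)} (h : Expands i j L) :
    Expands (inrIdx a i) (inrIdx a j) (L.map (inrIdx a)) where
  mul_eq := by
    rintro (v | v)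
    · exact (zero_mul _).trans (polySum_map_eq_zero (inrIdx a) L _ fun _ => rfl).symm
    · exact (h.mul_eq v).trans
        ((polySum_map_of_eq (inrIdx a) L v _ 1 fun _ => (one_mul _).symm).trans (one_mul _)).symm
  deg_le := by
    intro k hk
    obtain ⟨k', hk', rfl⟩ := List.mem_map.1 hk
    exact h.deg_le k' hk'
  self := fun hi hij => by rw [h.self hi (Sum.inr_injective hij)]; rfl
  ne := fun hi hj hij => by rw [h.ne hi hj fun h => hij (congrArg (inrIdx a) h)]; rfl

theorem Expands.inl_inr {a b : Ty} (i : Idx a) (j : Idx b) :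
    Expands (inlIdx b i) (inrIdx a j) [] where
  mul_eq := by
    rintro (v | v)
    · exact mul_zero _
    · exact zero_mul _
  deg_le := by simp
  self := fun _ h => absurd h Sum.inl_ne_inr
  ne := fun _ _ _ => rfl

theorem Expands.inr_inl {a b : Ty} (i : Idx b) (j : Idx a) :
    Expands (inrIdx a i) (inlIdx b j) [] where
  mul_eq := by
    rintro (v | v)
    · exact zero_mul _
    · exact mul_zero _
  deg_le := by simp
  self := fun _ h => absurd h Sum.inr_ne_inl
  ne := fun _ _ _ => rfl

theorem polySum_flatMap_pairIdx {a b : Ty} (L : List (Idx a)) (L' : List (Idx b)) (v : Val a)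
    (w : Val b) (u : Val (.prod a b)) (hu : u = Prod.mk (α := Val a) (β := Val b) v w) :
    polySum (L.flatMap fun i => L'.map (pairIdx i)) u = polySum L v * polySum L' w := by
  induction L with
  | nil => rw [polySum_nil, zero_mul]; rfl
  | cons i L ih =>
    rw [List.flatMap_cons, polySum_append, polySum_cons, ih, add_mul,
      polySum_map_of_eq (pairIdx i) L' w u (basePoly a i v) fun j => by rw [hu]; rfl]

theorem Expands.prod {a b : Ty} {i i' : Idx a} {j j' : Idx b} {L : List (Idx a)}
    {L' : List (Idx b)} (h : Expands i i' L) (h' : Expands j j' L') :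
    Expands (pairIdx i j) (pairIdx i' j') (L.flatMap fun i => L'.map (pairIdx i)) where
  mul_eq := by
    rintro ⟨v, w⟩
    rw [polySum_flatMap_pairIdx L L' v w _ rfl, ← h.mul_eq, ← h'.mul_eq]
    exact mul_mul_mul_comm _ _ _ _
  deg_le := by
    intro k hk
    obtain ⟨i₀, hi₀, hk⟩ := List.mem_flatMap.1 hk
    obtain ⟨j₀, hj₀, rfl⟩ := List.mem_map.1 hk
    have h₁ := h.deg_le _ hi₀
    have h₂ := h'.deg_le _ hj₀
    rw [deg_pairIdx, deg_pairIdx, deg_pairIdx]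
    omega
  self := by
    intro h0 heq
    rw [deg_pairIdx] at h0
    have heq := Prod.mk.inj heq
    rw [h.self (by omega) heq.1, h'.self (by omega) heq.2]
    rfl
  ne := by
    intro h0 h0' hne
    rw [deg_pairIdx] at h0 h0'
    by_cases hi : i = i'
    · have hj : j ≠ j' := fun hj => hne (by rw [hi, hj])
      rw [h'.ne (by omega) (by omega) hj]
      simp
    · rw [h.ne (by omega) (by omega) hi]
      rfl

theorem polySum_flatMap_consIdx_consVal {b : Ty} (M : List (Idx b)) (C : List (Idx (.list b)))
    (a : Val b) (v : Val (.list b)) :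
    polySum (M.flatMap fun h => C.map (consIdx h)) (consVal a v) =
      polySum (M.flatMap fun h => C.map (consIdx h)) v + polySum M a * polySum C v := by
  induction M with
  | nil => simp [polySum]
  | cons h M ih =>
    rw [List.flatMap_cons, polySum_append, polySum_append, ih, polySum_map_consIdx_consVal,
      polySum_cons]
    ring

theorem polySum_flatMap_consIdx_nilVal {b : Ty} (M : List (Idx b)) (C : List (Idx (.list b))) :
    polySum (M.flatMap fun h => C.map (consIdx h)) (nilVal b) = 0 := by
  induction M with
  | nil => rfl
  | cons h M ih => rw [List.flatMap_cons, polySum_append, ih, polySum_map_consIdx_nilVal]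

/-- The recursion of the quasi-shuffle product: the first element of the result stems from the
first list, from the second list, or from both. -/
theorem Expands.cons {b : Ty} {i j : Idx b} {k l : Idx (.list b)} {A B C : List (Idx (.list b))}
    {M : List (Idx b)} (hM : Expands i j M) (hA : Expands k (consIdx j l) A)
    (hB : Expands (consIdx i k) l B) (hC : Expands k l C) :
    Expands (consIdx i k) (consIdx j l)
      (A.map (consIdx i) ++ B.map (consIdx j) ++ M.flatMap fun h => C.map (consIdx h)) where
  mul_eq := by
    intro v
    induction v using valList_induction with
    | hnil =>
      rw [polySum_append, polySum_append, polySum_map_consIdx_nilVal, polySum_map_consIdx_nilVal,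
        polySum_flatMap_consIdx_nilVal, basePoly_consIdx_nilVal, zero_mul]
      rfl
    | hcons a v ih =>
      rw [polySum_append, polySum_append] at ih ⊢
      rw [polySum_map_consIdx_consVal, polySum_map_consIdx_consVal,
        polySum_flatMap_consIdx_consVal, ← hA.mul_eq, ← hB.mul_eq, ← hC.mul_eq, ← hM.mul_eq,
        basePoly_consIdx_consVal, basePoly_consIdx_consVal]
      linear_combination ih
  deg_le := by
    intro w hw
    rw [deg_consIdx, deg_consIdx]
    simp only [List.mem_append, List.mem_map, List.mem_flatMap] at hw
    rcases hw with (⟨u, hu, rfl⟩ | ⟨u, hu, rfl⟩) | ⟨h, hh, u, hu, rfl⟩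
    · have := hA.deg_le u hu
      rw [deg_consIdx] at this ⊢
      omega
    · have := hB.deg_le u hu
      rw [deg_consIdx] at this ⊢
      omega
    · have h₁ := hC.deg_le u hu
      have h₂ := hM.deg_le h hh
      rw [deg_consIdx]
      omega
  self := by
    intro h
    rw [deg_consIdx] at h
    omega
  ne := by
    intro h
    rw [deg_consIdx] at h
    omega

theorem Expands.nil_left {b : Ty} (l : Idx (.list b)) : Expands (nilIdx b) l [l] where
  mul_eq v := by rw [basePoly_nilIdx, polySum_singleton, one_mul]
  deg_le := by simp
  self := fun _ h => by rw [h]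
  ne := fun _ h hne => absurd ((deg_list_eq_zero l).1 h).symm hne

theorem Expands.nil_right {b : Ty} (k : Idx (.list b)) : Expands k (nilIdx b) [k] where
  mul_eq v := by rw [basePoly_nilIdx, polySum_singleton, mul_one]
  deg_le := by simp
  self := fun _ _ => rfl
  ne := fun h _ hne => absurd ((deg_list_eq_zero k).1 h) hne

theorem exists_expands (b : Ty) (i j : Idx b) : ∃ L, Expands i j L := by
  induction b with
  | unit => exact ⟨[()], fun _ => rfl, fun _ _ => Nat.zero_le _, fun _ _ => rfl,
      fun _ _ h => absurd rfl h⟩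
  | sum a b iha ihb =>
    rcases i with i | i <;> rcases j with j | j
    · obtain ⟨L, hL⟩ := iha i j
      exact ⟨_, hL.inl⟩
    · exact ⟨_, .inl_inr i j⟩
    · exact ⟨_, .inr_inl i j⟩
    · obtain ⟨L, hL⟩ := ihb i j
      exact ⟨_, hL.inr⟩
  | prod a b iha ihb =>
    obtain ⟨i, i'⟩ := i
    obtain ⟨j, j'⟩ := j
    obtain ⟨L, hL⟩ := iha i j
    obtain ⟨L', hL'⟩ := ihb i' j'
    exact ⟨_, hL.prod hL'⟩
  | list b ih =>
    induction i using idxList_induction generalizing j with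
    | hnil => exact ⟨_, .nil_left j⟩
    | hcons i k ihk =>
      induction j using idxList_induction with
      | hnil => exact ⟨_, .nil_right _⟩
      | hcons j l ihl =>
        obtain ⟨M, hM⟩ := ih i j
        obtain ⟨A, hA⟩ := ihk (consIdx j l)
        obtain ⟨B, hB⟩ := ihl
        obtain ⟨C, hC⟩ := ihk l
        exact ⟨_, hM.cons hA hB hC⟩

/-! ### Potentials -/

theorem potential_eq_linearCombination {b : Ty} (r : Ann b) (v : Val b) :
    potential r v = Finsupp.linearCombination NNRat (fun k => (basePoly b k v : NNRat)) r := by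
  rw [Finsupp.linearCombination_apply, Finsupp.sum, potential]
  refine finsum_eq_sum_of_support_subset _ fun k hk => ?_
  simp only [Function.mem_support, Finset.mem_coe, Finsupp.mem_support_iff] at hk ⊢
  exact left_ne_zero_of_mul hk

theorem potential₂_eq_linearCombination {b : Ty} (q : Idx b × Idx b →₀ NNRat) (v : Val b) :
    potential₂ (fun k₁ k₂ => q (k₁, k₂)) v = Finsupp.linearCombination NNRat
      (fun k : Idx b × Idx b => (basePoly b k.1 v : NNRat) * (basePoly b k.2 v : NNRat)) q := by
  rw [Finsupp.linearCombination_apply, Finsupp.sum, potential₂]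
  refine finsum_eq_sum_of_support_subset _ fun k hk => ?_
  simp only [Function.mem_support, Finset.mem_coe, Finsupp.mem_support_iff] at hk ⊢
  exact left_ne_zero_of_mul hk

/-- The potential of two copies of a value is a potential of the value. -/
theorem exists_linearization {b : Ty} (q : Idx b × Idx b →₀ NNRat) :
    ∃ r : Ann b, (∀ v, potential r v = potential₂ (fun k₁ k₂ => q (k₁, k₂)) v) ∧
      (∀ k, r k ≠ 0 → ∃ k₁ k₂, q (k₁, k₂) ≠ 0 ∧ deg b k ≤ deg b k₁ + deg b k₂) ∧
      ((∀ k₁ k₂, q (k₁, k₂) ≠ 0 → deg b k₁ = 0 ∧ deg b k₂ = 0) → ∀ k, r k = q (k, k)) := by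
  classical
  choose L hL using exists_expands b
  refine ⟨q.sum fun k c => ((L k.1 k.2).map fun i => Finsupp.single i c).sum,
    fun v => ?_, fun k hk => ?_, fun h0 k => ?_⟩
  · rw [potential_eq_linearCombination, potential₂_eq_linearCombination, map_finsuppSum,
      Finsupp.linearCombination_apply]
    refine Finsupp.sum_congr fun k _ => ?_
    have h := congrArg (Nat.cast : ℕ → NNRat) ((hL k.1 k.2).mul_eq v)
    rw [Nat.cast_mul] at h
    rw [h, map_list_sum, List.map_map, polySum, Nat.cast_list_sum, List.map_map, smul_eq_mul,
      ← List.sum_map_mul_left]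
    congr 1
    refine List.map_congr_left fun i _ => ?_
    simp
  · rw [Finsupp.sum, Finsupp.finsetSum_apply] at hk
    obtain ⟨⟨k₁, k₂⟩, hmem, hne⟩ := Finset.exists_ne_zero_of_sum_ne_zero hk
    refine ⟨k₁, k₂, Finsupp.mem_support_iff.1 hmem, (hL k₁ k₂).deg_le k ?_⟩
    by_contra hk
    refine hne ?_
    have key : ∀ l : List (Idx b), k ∉ l →
        (l.map fun i => Finsupp.single i (q (k₁, k₂))).sum k = 0 := by
      intro l hl
      induction l with
      | nil => rfl
      | cons i l ih =>
        simp only [List.mem_cons, not_or] at hl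
        rw [List.map_cons, List.sum_cons, Finsupp.add_apply, ih hl.2,
          Finsupp.single_eq_of_ne hl.1, add_zero]
    exact key _ hk
  · rw [Finsupp.sum, Finsupp.finsetSum_apply, Finset.sum_eq_single (k, k)]
    · by_cases hq : q (k, k) = 0
      · simp only [hq, Finsupp.single_zero]
        simp
      · rw [(hL k k).self (h0 k k hq).1 rfl]
        simp
    · rintro ⟨k₁, k₂⟩ hmem hne
      have hz := h0 k₁ k₂ (Finsupp.mem_support_iff.1 hmem)
      by_cases hk : k₁ = k₂
      · subst hk
        have hkk : k ≠ k₁ := fun h => hne (by rw [h])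
        rw [(hL k₁ k₁).self hz.1 rfl]
        simp [Finsupp.single_eq_of_ne hkk]
      · rw [(hL k₁ k₂).ne hz.1 hz.2 hk]
        rfl
    · intro h
      rw [Finsupp.notMem_support_iff] at h
      simp [h]

/-! ### Terms with controlled potential -/

/-- Each output annotation is dominated by one that is available in `A`, with an input annotation
that has the same bounds if the time class is `const` or the degree is zero. -/
def WeaklyFits {b₁ b₂ : Ty} (A : Set (Ann b₁ × Ann b₂)) (t : Time) : Prop :=
  ∀ Q : Ann b₂, ∃ Q' P, Q ≤ Q' ∧ (P, Q') ∈ A ∧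
    ∀ d n, Bound Q d n → t = .const ∨ d = 0 → Bound P d n

/-- Every output annotation of `e` can be paid for by a context annotation that satisfies all the
bounds of the output annotation, outside `V`. -/
def Controlled (T : FAnn) (S : Finset FVar) (Γ : Finset BVar) (e : Tm) (b : Ty)
    (V : Finset BVar) : Prop :=
  ∀ Q : Ann b, ∃ P : CAnn Γ, Typed T S Γ P e (.base b Q) ∧
    ∀ d n, Bound Q d n → CBound P d n V

theorem Fits.weaklyFits {b₁ b₂ : Ty} {A : Set (Ann b₁ × Ann b₂)} {t : Time} (h : Fits A t) :
    WeaklyFits A t := by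
  intro Q
  obtain ⟨d, n, hQ, hmin⟩ := exists_least_bound Q
  obtain ⟨Q', hle, hQ'⟩ := hQ.exists_uniform
  obtain ⟨P, hP, hu⟩ := h d n Q' hQ'
  refine ⟨Q', P, hle, hP, fun d' n' hb ht => ?_⟩
  have hdn := hmin d' n' hb
  refine (hu (ht.imp_right fun h0 => ?_)).bound.mono hdn
  omega

theorem CBound.of_zero {Γ : Finset BVar} {P : CAnn Γ} {n : ℕ} {V : Finset BVar}
    (h : CBound P 0 n V) (V' : Finset BVar) : CBound P 0 n V' := fun γ hγ =>
  Or.inr ((h γ hγ).resolve_left (Nat.not_lt_zero _))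

theorem CBound.of_subset {Γ : Finset BVar} {P : CAnn Γ} {d n : ℕ} {V V' : Finset BVar}
    (h : CBound P d n V) (hV : V ⊆ V') : CBound P d n V' := fun γ hγ =>
  (h γ hγ).imp_left (outDeg_anti γ fun _ _ hz => hV hz).trans_lt

theorem cBound_insert_iff {Γ V : Finset BVar} {x : BVar} (hx : x ∉ Γ) (P : CAnn (insert x Γ))
    (d n : ℕ) : CBound P d n V ↔ ∀ (γ : CIdx Γ) (k : Idx x.ty), P (γ.ext x k) ≠ 0 →
      (if x ∈ V then 0 else deg x.ty k) + outDeg V γ < d ∨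
        (deg x.ty k + outDeg ∅ γ ≤ d ∧ P (γ.ext x k) ≤ n) := by
  constructor
  · intro h γ k hk
    have := h _ hk
    rwa [outDeg_ext γ hx, total_ext γ hx] at this
  · intro h ψ
    induction ψ using CIdx.ext_cases with
    | h γ k =>
      rw [outDeg_ext γ hx, total_ext γ hx]
      exact h γ k

theorem mem_replaceVar {Γ V W : Finset BVar} {x y : BVar} (hV : V ⊆ insert x Γ) (hy : y ∉ Γ)
    (hW : y ∈ W) : y ∈ replaceVar V x W ↔ x ∈ V := by
  unfold replaceVar
  split_ifs with hx
  · simp [hx, hW]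
  · simp only [hx, iff_false]
    intro hyV
    rcases Finset.mem_insert.1 (hV hyV) with rfl | h
    · exact hx hyV
    · exact hy h

theorem outDeg_replaceVar {Γ V W : Finset BVar} {x : BVar} (hx : x ∉ Γ) (hW : ∀ y ∈ W, y ∉ Γ)
    (γ : CIdx Γ) : outDeg (replaceVar V x W) γ = outDeg V γ := by
  refine outDeg_congr γ fun z hz => ?_
  have hzx : z ≠ x := fun h => hx (h ▸ hz)
  have hzW : z ∉ W := fun h => hW z h hz
  unfold replaceVar
  split_ifs <;> simp [hzx, hzW]

theorem outDeg_replaceVar_ext {Γ V : Finset BVar} {x y : BVar} (hx : x ∉ Γ) (hy : y ∉ Γ)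
    (hV : V ⊆ insert x Γ) (γ : CIdx Γ) (k : Idx y.ty) :
    outDeg (replaceVar V x {y}) (γ.ext y k) =
      (if x ∈ V then 0 else deg y.ty k) + outDeg V γ := by
  rw [outDeg_ext γ hy, outDeg_replaceVar hx (by simpa using hy)]
  simp only [mem_replaceVar hV hy (Finset.mem_singleton_self y)]

theorem notMem_insert {Γ : Finset BVar} {y z : BVar} (hy : y ∉ Γ) (hyz : y ≠ z) :
    y ∉ insert z Γ := by
  simp [hy, hyz]

theorem outDeg_replaceVar_ext_ext {Γ V : Finset BVar} {x y z : BVar} (hx : x ∉ Γ) (hy : y ∉ Γ)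
    (hz : z ∉ Γ) (hyz : y ≠ z) (hV : V ⊆ insert x Γ) (γ : CIdx Γ) (j : Idx y.ty) (k : Idx z.ty) :
    outDeg (replaceVar V x {y, z}) ((γ.ext z k).ext y j) =
      (if x ∈ V then 0 else deg y.ty j + deg z.ty k) + outDeg V γ := by
  rw [outDeg_ext _ (notMem_insert hy hyz), outDeg_ext γ hz,
    outDeg_replaceVar hx (by simp [hy, hz])]
  simp only [mem_replaceVar hV hy (Finset.mem_insert_self y {z}),
    mem_replaceVar hV hz (show z ∈ ({y, z} : Finset BVar) by simp)]
  split_ifs <;> omega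

theorem total_ext_ext {Γ : Finset BVar} {y z : BVar} (hy : y ∉ Γ) (hz : z ∉ Γ) (hyz : y ≠ z)
    (γ : CIdx Γ) (j : Idx y.ty) (k : Idx z.ty) :
    outDeg ∅ ((γ.ext z k).ext y j) = (deg y.ty j + deg z.ty k) + outDeg ∅ γ := by
  rw [total_ext _ (notMem_insert hy hyz), total_ext γ hz, add_assoc]

theorem ty_ne_list (b : Ty) : b ≠ .list b := by
  intro h
  have := congrArg sizeOf h
  simp at this

theorem bvar_ne_list (n m : ℕ) (b : Ty) : BVar.mk n b ≠ BVar.mk m (.list b) :=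
  fun h => ty_ne_list b (congrArg BVar.ty h)

/-! ### Variables, constructors and functions -/

theorem CIdx.single_self (x : BVar) (k : Idx x.ty) (h : x ∈ ({x} : Finset BVar)) :
    CIdx.single x k x h = k := rfl

theorem CIdx.eq_single {x : BVar} (γ : CIdx {x}) :
    γ = CIdx.single x (γ x (Finset.mem_singleton_self x)) := by
  funext z hz
  obtain rfl := Finset.mem_singleton.1 hz
  rfl

theorem exists_cAnn_singleton {x : BVar} (Q : Ann x.ty) : ∃ P : CAnn {x},
    (∀ γ : CIdx {x}, P γ = Q (γ x (Finset.mem_singleton_self x))) ∧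
      ∀ d n V, Bound Q d n → CBound P d n V := by
  obtain ⟨N, hN⟩ := exists_deg_le Q
  obtain ⟨P, hP⟩ := exists_cAnn_of_total_le
    (fun γ : CIdx {x} => Q (γ x (Finset.mem_singleton_self x))) N fun γ hγ => by
      rw [outDeg_singleton]
      simpa using hN _ hγ
  refine ⟨P, hP, fun d n V h => CBound.of_subset (V := ∅) ?_ (Finset.empty_subset V)⟩
  intro γ hγ
  rw [hP] at hγ ⊢
  simpa [outDeg_singleton] using h _ hγ

theorem exists_ann_of_cAnn_singleton {x : BVar} (P : CAnn {x}) : ∃ Q : Ann x.ty,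
    (∀ γ : CIdx {x}, P γ = Q (γ x (Finset.mem_singleton_self x))) ∧
      ∀ d n, CBound P d n ∅ → Bound Q d n := by
  obtain ⟨N, hN⟩ := exists_total_le P
  obtain ⟨Q, hQ⟩ := exists_finsupp_of_deg_le (fun k => P (CIdx.single x k)) N fun k hk => by
    simpa [outDeg_singleton, CIdx.single_self] using hN _ hk
  refine ⟨Q, fun γ => by rw [hQ, ← CIdx.eq_single], fun d n h k hk => ?_⟩
  rw [hQ] at hk ⊢
  simpa [outDeg_singleton, CIdx.single_self] using h _ hk

theorem Controlled.var (T : FAnn) (x : BVar) : Controlled T ∅ {x} (.var x) x.ty ∅ := by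
  intro Q
  obtain ⟨P, hP, hb⟩ := exists_cAnn_singleton Q
  exact ⟨P, .var x P Q hP, fun d n => hb d n ∅⟩

theorem Controlled.inl (T : FAnn) (x : BVar) (b₂ : Ty) :
    Controlled T ∅ {x} (.inl x b₂) (.sum x.ty b₂) ∅ := by
  intro Q
  obtain ⟨N, hN⟩ := exists_deg_le Q
  obtain ⟨Q₁, hQ₁⟩ := exists_finsupp_of_deg_le (fun i : Idx x.ty => Q (inlIdx b₂ i)) N
    fun i hi => hN _ hi
  obtain ⟨P, hP, hb⟩ := exists_cAnn_singleton Q₁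
  refine ⟨P, .sumL x b₂ P Q fun γ => (hP γ).trans (hQ₁ _), fun d n h => hb d n ∅ fun i hi => ?_⟩
  rw [hQ₁] at hi ⊢
  exact h _ hi

theorem Controlled.inr (T : FAnn) (x : BVar) (b₁ : Ty) :
    Controlled T ∅ {x} (.inr b₁ x) (.sum b₁ x.ty) ∅ := by
  intro Q
  obtain ⟨N, hN⟩ := exists_deg_le Q
  obtain ⟨Q₁, hQ₁⟩ := exists_finsupp_of_deg_le (fun i : Idx x.ty => Q (inrIdx b₁ i)) N
    fun i hi => hN _ hi
  obtain ⟨P, hP, hb⟩ := exists_cAnn_singleton Q₁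
  refine ⟨P, .sumR x b₁ P Q fun γ => (hP γ).trans (hQ₁ _), fun d n h => hb d n ∅ fun i hi => ?_⟩
  rw [hQ₁] at hi ⊢
  exact h _ hi

theorem outDeg_empty {V : Finset BVar} (γ : CIdx ∅) : outDeg V γ = 0 := rfl

theorem exists_cAnn_empty {b : Ty} (Q : Ann b) (i : Idx b) (hi : deg b i = 0) : ∃ P : CAnn ∅,
    (∀ γ : CIdx ∅, P γ = Q i) ∧ ∀ d n, Bound Q d n → CBound P d n ∅ := by
  obtain ⟨P, hP⟩ := exists_cAnn_of_total_le (fun _ : CIdx ∅ => Q i) 0 fun γ _ =>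
    (outDeg_empty γ).le
  refine ⟨P, hP, fun d n h γ hγ => ?_⟩
  rw [hP] at hγ ⊢
  simpa [outDeg_empty, hi] using h i hγ

theorem Controlled.unit (T : FAnn) : Controlled T ∅ ∅ .unit .unit ∅ := by
  intro Q
  obtain ⟨P, hP, hb⟩ := exists_cAnn_empty Q () rfl
  exact ⟨P, .unit P Q hP, hb⟩

theorem Controlled.nil (T : FAnn) (b : Ty) : Controlled T ∅ ∅ (.nil b) (.list b) ∅ := by
  intro Q
  obtain ⟨P, hP, hb⟩ := exists_cAnn_empty Q (nilIdx b) rfl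
  exact ⟨P, .nil b P Q hP, hb⟩

theorem Controlled.pair (T : FAnn) {x₁ x₂ : BVar} (hne : x₁ ≠ x₂) :
    Controlled T ∅ {x₁, x₂} (.pair x₁ x₂) (.prod x₁.ty x₂.ty) ∅ := by
  intro Q
  obtain ⟨N, hN⟩ := exists_deg_le Q
  have hdeg : ∀ γ : CIdx {x₁, x₂}, outDeg ∅ γ =
      deg (.prod x₁.ty x₂.ty) (pairIdx (γ x₁ (by simp)) (γ x₂ (by simp))) := fun γ => by
    simp [outDeg_pair hne, deg_pairIdx]
  obtain ⟨P, hP⟩ := exists_cAnn_of_total_le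
    (fun γ : CIdx {x₁, x₂} => Q (pairIdx (γ x₁ (by simp)) (γ x₂ (by simp)))) N fun γ hγ =>
      (hdeg γ).trans_le (hN _ hγ)
  refine ⟨P, .pair x₁ x₂ hne P Q hP, fun d n h γ hγ => ?_⟩
  rw [hdeg, hP] at *
  exact h _ hγ

theorem Controlled.cons (T : FAnn) (n₁ n₂ : ℕ) (b : Ty) :
    Controlled T ∅ {BVar.mk n₁ b, BVar.mk n₂ (.list b)}
      (.cons (BVar.mk n₁ b) (BVar.mk n₂ (.list b))) (.list b) ∅ := by
  intro Q
  obtain ⟨N, hN⟩ := exists_deg_le Q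
  have hne := bvar_ne_list n₁ n₂ b
  let j : CIdx {BVar.mk n₁ b, BVar.mk n₂ (.list b)} → Idx b := fun γ =>
    γ (BVar.mk n₁ b) (by simp)
  let k : CIdx {BVar.mk n₁ b, BVar.mk n₂ (.list b)} → Idx (.list b) := fun γ =>
    γ (BVar.mk n₂ (.list b)) (by simp)
  have hdeg : ∀ γ, outDeg ∅ γ = deg b (j γ) + deg (.list b) (k γ) := fun γ => by
    simp [outDeg_pair hne, j, k]
  have hshift : ∀ (d n : ℕ), Bound Q d n → ∀ γ, shift Q (j γ) (k γ) ≠ 0 →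
      outDeg ∅ γ < d ∨ (outDeg ∅ γ ≤ d ∧ shift Q (j γ) (k γ) ≤ n) := by
    intro d n h γ hγ
    rw [hdeg]
    unfold shift at hγ ⊢
    by_cases hc : Q (consIdx (j γ) (k γ)) = 0
    · rw [hc, zero_add] at hγ ⊢
      by_cases h0 : deg b (j γ) = 0
      · rw [if_pos h0] at hγ ⊢
        simpa [h0] using h _ hγ
      · simp [h0] at hγ
    · have := h.deg_le _ hc
      rw [deg_consIdx] at this
      omega
  obtain ⟨m, hm⟩ := exists_bound_of_deg_le Q N hN
  obtain ⟨P, hP⟩ := exists_cAnn_of_total_le (fun γ => shift Q (j γ) (k γ)) N fun γ hγ => by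
    rcases hshift N m hm γ hγ with h | h <;> omega
  refine ⟨P, .cons n₁ n₂ b P Q hP, fun d n h γ hγ => ?_⟩
  rw [hP] at hγ ⊢
  exact hshift d n h γ hγ

theorem Controlled.app {T : FAnn} (f x : ℕ) {b₁ b₂ : Ty} {t : Time} {V : Finset BVar}
    (h : WeaklyFits (T ⟨f, b₁, b₂⟩) t) (hV : t = .const ∨ BVar.mk x b₁ ∈ V) :
    Controlled T {⟨f, b₁, b₂⟩} {BVar.mk x b₁} (.app ⟨f, b₁, b₂⟩ (BVar.mk x b₁)) b₂ V := by
  intro Q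
  obtain ⟨Q', P', hle, hmem, hb⟩ := h Q
  obtain ⟨P, hP, hPb⟩ := exists_cAnn_singleton (x := BVar.mk x b₁) P'
  refine ⟨P, .sub P Q' Q hle (.app f x b₁ b₂ P P' Q' hmem hP), fun d n hQ => ?_⟩
  rcases Nat.eq_zero_or_pos d with h0 | h0
  · exact hPb d n V (hb d n hQ (Or.inr h0))
  · rcases hV with ht | hV
    · exact hPb d n V (hb d n hQ (Or.inl ht))
    · -- the only variable is in `V`, so that the degree outside `V` is zero
      exact fun γ _ => Or.inl (by rwa [outDeg_singleton, if_pos hV])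

theorem Controlled.lam {T : FAnn} {S : Finset FVar} {x : BVar} {e : Tm} {b : Ty}
    {V : Finset BVar} (h : Controlled T S {x} e b V) (Q : Ann b) : ∃ P : Ann x.ty,
      Typed T S ∅ 0 (.lam x e) (.arrow x.ty b P Q) ∧
        ∀ d n, Bound Q d n → V = ∅ ∨ d = 0 → Bound P d n := by
  obtain ⟨P', hP', hb⟩ := h Q
  obtain ⟨P, hP, hPb⟩ := exists_ann_of_cAnn_singleton P'
  refine ⟨P, .lam x b P Q P' hP hP', fun d n hQ hV => hPb d n ?_⟩
  rcases hV with rfl | rfl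
  · exact hb d n hQ
  · exact (hb 0 n hQ).of_zero ∅

/-! ### Pattern matching, sharing, sequencing and weakening -/

theorem Controlled.caseSum {T : FAnn} {S : Finset FVar} {Γ V : Finset BVar} {e₁ e₂ : Tm} {b : Ty}
    {x y₁ y₂ : ℕ} {b₁ b₂ : Ty}
    (hx : BVar.mk x (.sum b₁ b₂) ∉ Γ) (hy₁ : BVar.mk y₁ b₁ ∉ Γ) (hy₂ : BVar.mk y₂ b₂ ∉ Γ)
    (hV : V ⊆ insert (BVar.mk x (.sum b₁ b₂)) Γ)
    (h₁ : Controlled T S (insert (BVar.mk y₁ b₁) Γ) e₁ b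
      (replaceVar V (BVar.mk x (.sum b₁ b₂)) {BVar.mk y₁ b₁}))
    (h₂ : Controlled T S (insert (BVar.mk y₂ b₂) Γ) e₂ b
      (replaceVar V (BVar.mk x (.sum b₁ b₂)) {BVar.mk y₂ b₂})) :
    Controlled T S (insert (BVar.mk x (.sum b₁ b₂)) Γ)
      (.caseSum (BVar.mk x (.sum b₁ b₂)) (BVar.mk y₁ b₁) e₁ (BVar.mk y₂ b₂) e₂) b V := by
  intro Q
  obtain ⟨P₁, ht₁, hb₁⟩ := h₁ Q
  obtain ⟨P₂, ht₂, hb₂⟩ := h₂ Q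
  obtain ⟨N₁, hN₁⟩ := exists_total_le P₁
  obtain ⟨N₂, hN₂⟩ := exists_total_le P₂
  obtain ⟨P, hP⟩ := exists_cAnn_insert hx
    (fun γ (k : Idx b₁ ⊕ Idx b₂) => Sum.elim (fun i => P₁ (γ.ext (BVar.mk y₁ b₁) i))
      (fun i => P₂ (γ.ext (BVar.mk y₂ b₂) i)) k) (max N₁ N₂) (by
    rintro γ (i | i) hi
    · have := hN₁ _ hi
      rw [total_ext γ hy₁] at this
      exact this.trans (le_max_left _ _)
    · have := hN₂ _ hi
      rw [total_ext γ hy₂] at this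
      exact this.trans (le_max_right _ _))
  refine ⟨P, .caseSum x y₁ y₂ b₁ b₂ hx hy₁ hy₂ P P₁ P₂ (fun γ i => (hP γ (Sum.inl i)).symm)
    (fun γ i => (hP γ (Sum.inr i)).symm) ht₁ ht₂, fun d n hQ => ?_⟩
  rw [cBound_insert_iff hx]
  intro γ i hi
  induction i using idxSum_cases with
  | hinl i =>
    rw [hP] at hi ⊢
    have := hb₁ d n hQ _ hi
    rw [outDeg_replaceVar_ext hx hy₁ hV, total_ext γ hy₁] at this
    exact this
  | hinr i =>
    rw [hP] at hi ⊢
    have := hb₂ d n hQ _ hi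
    rw [outDeg_replaceVar_ext hx hy₂ hV, total_ext γ hy₂] at this
    exact this

theorem Controlled.casePair {T : FAnn} {S : Finset FVar} {Γ V : Finset BVar} {e : Tm} {b : Ty}
    {x x₁ x₂ : ℕ} {b₁ b₂ : Ty}
    (hx : BVar.mk x (.prod b₁ b₂) ∉ Γ) (hx₁ : BVar.mk x₁ b₁ ∉ Γ) (hx₂ : BVar.mk x₂ b₂ ∉ Γ)
    (hne : BVar.mk x₁ b₁ ≠ BVar.mk x₂ b₂) (hV : V ⊆ insert (BVar.mk x (.prod b₁ b₂)) Γ)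
    (h : Controlled T S (insert (BVar.mk x₁ b₁) (insert (BVar.mk x₂ b₂) Γ)) e b
      (replaceVar V (BVar.mk x (.prod b₁ b₂)) {BVar.mk x₁ b₁, BVar.mk x₂ b₂})) :
    Controlled T S (insert (BVar.mk x (.prod b₁ b₂)) Γ)
      (.casePair (BVar.mk x (.prod b₁ b₂)) (BVar.mk x₁ b₁) (BVar.mk x₂ b₂) e) b V := by
  intro Q
  obtain ⟨P₁, ht, hb⟩ := h Q
  obtain ⟨N, hN⟩ := exists_total_le P₁
  obtain ⟨P, hP⟩ := exists_cAnn_insert hx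
    (fun γ (k : Idx b₁ × Idx b₂) =>
      P₁ ((γ.ext (BVar.mk x₂ b₂) k.2).ext (BVar.mk x₁ b₁) k.1)) N (by
    rintro γ ⟨i, j⟩ hi
    have := hN _ hi
    rw [total_ext_ext hx₁ hx₂ hne] at this
    exact this)
  refine ⟨P, .caseProd x x₁ x₂ b₁ b₂ hx hx₁ hx₂ hne P P₁ (fun γ i j => (hP γ (i, j)).symm) ht,
    fun d n hQ => ?_⟩
  rw [cBound_insert_iff hx]
  intro γ i hi
  induction i using idxProd_cases with
  | hpair i j =>
    rw [hP] at hi ⊢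
    have := hb d n hQ _ hi
    rw [outDeg_replaceVar_ext_ext hx hx₁ hx₂ hne hV, total_ext_ext hx₁ hx₂ hne] at this
    exact this

/-- Elements without lists have degree zero. The coefficient of the tail index `k` therefore also
serves as that of `k` before the match, and the coefficients for all element indexes can be
covered at once by their maximum. -/
theorem Controlled.caseList {T : FAnn} {S : Finset FVar} {Γ V : Finset BVar} {e₀ e₁ : Tm}
    {b₂ : Ty} {x y ys : ℕ} {b : Ty} (hfree : b.ListFree)
    (hx : BVar.mk x (.list b) ∉ Γ) (hy : BVar.mk y b ∉ Γ) (hys : BVar.mk ys (.list b) ∉ Γ)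
    (hV : V ⊆ insert (BVar.mk x (.list b)) Γ)
    (h₀ : Controlled T S Γ e₀ b₂ (V.erase (BVar.mk x (.list b))))
    (h₁ : Controlled T S (insert (BVar.mk y b) (insert (BVar.mk ys (.list b)) Γ)) e₁ b₂
      (replaceVar V (BVar.mk x (.list b)) {BVar.mk y b, BVar.mk ys (.list b)})) :
    Controlled T S (insert (BVar.mk x (.list b)) Γ)
      (.caseList (BVar.mk x (.list b)) e₀ (BVar.mk y b) (BVar.mk ys (.list b)) e₁) b₂ V := by
  classical
  intro Q
  have hne := bvar_ne_list y ys b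
  have hyi := notMem_insert hy hne
  obtain ⟨P₀, ht₀, hb₀⟩ := h₀ Q
  obtain ⟨P₁, ht₁, hb₁⟩ := h₁ Q
  obtain ⟨N₀, hN₀⟩ := exists_total_le P₀
  obtain ⟨N₁, hN₁⟩ := exists_total_le P₁
  have hz : ∀ j : Idx b, deg b j = 0 := deg_eq_zero_of_listFree hfree
  have hfin : Finite (Idx b) := by
    rw [← Set.finite_univ_iff]
    exact (finite_deg_le b 0).subset fun j _ => (hz j).le
  have := Fintype.ofFinite (Idx b)
  let g : CIdx Γ → Idx (.list b) → Idx b → NNRat := fun γ k j =>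
    P₁ ((γ.ext (BVar.mk ys (.list b)) k).ext (BVar.mk y b) j)
  let g₀ : CIdx Γ → Idx (.list b) → NNRat := fun γ k => if k = nilIdx b then P₀ γ else 0
  -- a maximum is one of the coefficients in question, or zero
  have hmax : ∀ γ k, (Finset.univ.sup (g γ k) ⊔ g₀ γ k) ≠ 0 →
      (∃ j, g γ k j ≠ 0 ∧ Finset.univ.sup (g γ k) ⊔ g₀ γ k = g γ k j) ∨
      (k = nilIdx b ∧ P₀ γ ≠ 0 ∧ Finset.univ.sup (g γ k) ⊔ g₀ γ k = P₀ γ) := by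
    intro γ k hk
    rcases le_total (g₀ γ k) (Finset.univ.sup (g γ k)) with hle | hle
    · rw [sup_eq_left.2 hle] at hk ⊢
      rcases isEmpty_or_nonempty (Idx b) with hemp | hnon
      · exact absurd (by simp) hk
      · obtain ⟨j, -, hj⟩ := Finset.exists_mem_eq_sup _ Finset.univ_nonempty (g γ k)
        exact Or.inl ⟨j, hj ▸ hk, hj⟩
    · rw [sup_eq_right.2 hle] at hk ⊢
      by_cases h : k = nilIdx b
      · simp only [g₀, if_pos h] at hk ⊢
        exact Or.inr ⟨h, hk, trivial⟩
      · simp [g₀, if_neg h] at hk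
  have htot : ∀ (γ : CIdx Γ) (k : Idx (.list b)) (j : Idx b),
      outDeg ∅ ((γ.ext (BVar.mk ys (.list b)) k).ext (BVar.mk y b) j) =
        deg (.list b) k + outDeg ∅ γ := fun γ k j => by
    rw [total_ext_ext hy hys hne, hz j, zero_add]
  obtain ⟨P, hP⟩ := exists_cAnn_insert hx (fun γ k => Finset.univ.sup (g γ k) ⊔ g₀ γ k)
    (max N₀ N₁) (by
      intro γ k hk
      rcases hmax γ k hk with ⟨j, hj, -⟩ | ⟨rfl, hγ, -⟩
      · exact (htot γ k j).ge.trans ((hN₁ _ hj).trans (le_max_right _ _))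
      · have := hN₀ γ hγ
        exact ((zero_add _).le.trans this).trans (le_max_left _ _))
  -- the annotations of the two branches that arise from `P` by pattern matching
  obtain ⟨P₀', hP₀'⟩ := exists_cAnn_of_total_le
    (fun γ => P (γ.ext (BVar.mk x (.list b)) (nilIdx b))) (max N₀ N₁) fun γ hγ => by
      rw [hP] at hγ
      rcases hmax γ _ hγ with ⟨j, hj, -⟩ | ⟨-, hγ, -⟩
      · have := hN₁ _ hj
        rw [htot] at this
        omega
      · have := hN₀ γ hγ
        omega
  obtain ⟨N, hN⟩ := exists_total_le P
  obtain ⟨P₁', hP₁'⟩ := exists_cAnn_insert hyi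
    (fun ψ j => shift (slice (BVar.mk x (.list b)) P (ψ.restrict (Finset.subset_insert _ Γ))) j
      (ψ (BVar.mk ys (.list b)) (Finset.mem_insert_self _ Γ))) N (by
    intro ψ j
    induction ψ using CIdx.ext_cases with
    | h γ k =>
      rw [CIdx.restrict_ext γ hys, CIdx.ext_self, total_ext γ hys]
      intro hk
      change deg b j + (deg (.list b) k + outDeg ∅ γ) ≤ N
      rw [hz j, zero_add]
      by_cases hc : slice (BVar.mk x (.list b)) P γ (consIdx j k) = 0
      · rw [shift, hc, if_pos (hz j), zero_add] at hk
        have := hN _ hk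
        rwa [total_ext γ hx] at this
      · have := hN _ hc
        rw [total_ext γ hx] at this
        rw [deg_consIdx] at this
        omega)
  have hP₁'' : ∀ (γ : CIdx Γ) (j : Idx b) (k : Idx (.list b)),
      P₁' ((γ.ext (BVar.mk ys (.list b)) k).ext (BVar.mk y b) j) =
        shift (slice (BVar.mk x (.list b)) P γ) j k := fun γ j k => by
    rw [hP₁', CIdx.restrict_ext γ hys, CIdx.ext_self]
  refine ⟨P, .caseList x y ys b hx hy hys P P₀' P₁' hP₀' hP₁'' (.sup P₀ P₀' (fun γ => ?_) ht₀)
    (.sup P₁ P₁' (fun ψ => ?_) ht₁), fun d n hQ => ?_⟩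
  · rw [hP₀', hP]
    simp only [g₀, if_pos]
    exact le_sup_right
  · induction ψ using CIdx.ext_cases with
    | h ψ j =>
      induction ψ using CIdx.ext_cases with
      | h γ k =>
        rw [hP₁'', shift, if_pos (hz j), slice, slice, hP γ k]
        exact (Finset.le_sup (f := g γ k) (Finset.mem_univ j)).trans
          (le_sup_left.trans le_add_self)
  · rw [cBound_insert_iff hx]
    intro γ k hk
    rw [hP] at hk ⊢
    rcases hmax γ k hk with ⟨j, hj, heq⟩ | ⟨rfl, hγ, heq⟩
    · have := hb₁ d n hQ _ hj
      rw [outDeg_replaceVar_ext_ext hx hy hys hne hV, htot, hz j, zero_add] at this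
      rw [heq]
      exact this
    · have := hb₀ d n hQ γ hγ
      rw [outDeg_congr (V' := V) γ fun z hz => by
        have hzx : z ≠ BVar.mk x (.list b) := fun h => hx (h ▸ hz)
        simp [hzx]] at this
      rw [heq]
      simpa [deg_nilIdx] using this

theorem Controlled.shareBase {T : FAnn} {S : Finset FVar} {Γ V : Finset BVar} {e : Tm} {b : Ty}
    {x x₁ x₂ : ℕ} {b' : Ty} (hxV : BVar.mk x b' ∈ V)
    (hx : BVar.mk x b' ∉ Γ) (hx₁ : BVar.mk x₁ b' ∉ Γ) (hx₂ : BVar.mk x₂ b' ∉ Γ) (hne : x₁ ≠ x₂)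
    (hV : V ⊆ insert (BVar.mk x b') Γ)
    (h : Controlled T S (insert (BVar.mk x₁ b') (insert (BVar.mk x₂ b') Γ)) e b
      (replaceVar V (BVar.mk x b') {BVar.mk x₁ b', BVar.mk x₂ b'})) :
    Controlled T S (insert (BVar.mk x b') Γ)
      (.shareBase (BVar.mk x b') (BVar.mk x₁ b') (BVar.mk x₂ b') e) b V := by
  intro Q
  have hne' : BVar.mk x₁ b' ≠ BVar.mk x₂ b' := fun h => hne (congrArg BVar.name h)
  obtain ⟨P₁, ht, hb⟩ := h Q
  obtain ⟨N, hN⟩ := exists_total_le P₁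
  let g : CIdx Γ → Idx b' → Idx b' → NNRat := fun γ k₁ k₂ =>
    P₁ ((γ.ext (BVar.mk x₂ b') k₂).ext (BVar.mk x₁ b') k₁)
  have hg : ∀ γ k₁ k₂, g γ k₁ k₂ ≠ 0 → (deg b' k₁ + deg b' k₂) + outDeg ∅ γ ≤ N :=
    fun γ k₁ k₂ hk => total_ext_ext hx₁ hx₂ hne' γ k₁ k₂ ▸ hN _ hk
  have hq : ∀ γ, ∃ q : Idx b' × Idx b' →₀ NNRat, ∀ k₁ k₂, q (k₁, k₂) = g γ k₁ k₂ := fun γ => by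
    obtain ⟨q, hq⟩ := exists_finsupp_of_deg_le (b := .prod b' b')
      (fun k : Idx b' × Idx b' => g γ k.1 k.2) N
      (fun ⟨k₁, k₂⟩ hk => (Nat.le_add_right _ _).trans (hg γ k₁ k₂ hk))
    exact ⟨q, fun k₁ k₂ => hq (k₁, k₂)⟩
  choose q hq using hq
  choose r hr hrdeg hrzero using fun γ => exists_linearization (q γ)
  obtain ⟨P, hP⟩ := exists_cAnn_insert hx (fun γ k => r γ k) N (by
    intro γ k hk
    obtain ⟨k₁, k₂, hk', hle⟩ := hrdeg γ k hk
    rw [hq] at hk'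
    have := hg γ k₁ k₂ hk'
    dsimp only
    omega)
  have hslice : ∀ γ, slice (BVar.mk x b') P γ = r γ := fun γ => funext (hP γ)
  refine ⟨P, .shareBase x x₁ x₂ b' hx hx₁ hx₂ hne P P₁ (fun γ v => ?_) ht, fun d n hQ => ?_⟩
  · rw [hslice, hr]
    simp only [hq]
    rfl
  · rw [cBound_insert_iff hx]
    intro γ k hk
    rw [hP] at hk ⊢
    rw [if_pos hxV, zero_add]
    by_cases hd : outDeg V γ < d
    · exact Or.inl hd
    -- here the variables outside `V` carry the full degree, so that only the indexes of degree
    -- zero of the two copies matter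
    · have hkey : ∀ k₁ k₂, q γ (k₁, k₂) ≠ 0 →
          (deg b' k₁ + deg b' k₂) + outDeg ∅ γ ≤ d ∧ q γ (k₁, k₂) ≤ n := by
        intro k₁ k₂ hk
        rw [hq] at hk ⊢
        have := hb d n hQ _ hk
        rw [outDeg_replaceVar_ext_ext hx hx₁ hx₂ hne' hV, if_pos hxV, zero_add,
          total_ext_ext hx₁ hx₂ hne'] at this
        exact this.resolve_left hd
      have hle := outDeg_le_total V γ
      have heq := hrzero γ (fun k₁ k₂ hk => by
        have := (hkey k₁ k₂ hk).1
        omega) k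
      rw [heq] at hk ⊢
      have := hkey k k hk
      refine Or.inr ⟨?_, this.2⟩
      have := this.1
      dsimp only
      omega

theorem Controlled.letBase {T : FAnn} {S₁ S₂ : Finset FVar} {Γ₁ Γ₂ V₁ V₂ V : Finset BVar}
    {e₁ e₂ : Tm} {b : Ty} {x : BVar}
    (hS : Disjoint S₁ S₂) (hΓ : Disjoint Γ₁ Γ₂) (hx : x ∉ Γ₂)
    (hV : V = if x ∈ V₂ then Γ₁ ∪ V₂.erase x else V₁ ∪ V₂)
    (h₁ : Controlled T S₁ Γ₁ e₁ x.ty V₁) (h₂ : Controlled T S₂ (insert x Γ₂) e₂ b V₂) :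
    Controlled T (S₁ ∪ S₂) (Γ₁ ∪ Γ₂) (.letBase x e₁ e₂) b V := by
  intro Q
  obtain ⟨R, ht₂, hb₂⟩ := h₂ Q
  choose F ht₁ hb₁ using h₁
  choose R' hR' using exists_ann_slice hx R
  obtain ⟨N, hN⟩ := exists_total_le R
  have hF0 : F 0 = 0 := eq_zero_of_cBound_zero (hb₁ 0 0 0 bound_zero)
  -- a nonzero coefficient of `F (R' j)` comes with a nonzero coefficient of `R' j`
  have hex : ∀ j i, F (R' j) i ≠ 0 → ∃ k, R' j k ≠ 0 := by
    intro j i hi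
    by_contra hcon
    push Not at hcon
    have : R' j = 0 := Finsupp.ext hcon
    rw [this, hF0] at hi
    exact hi rfl
  have hj : ∀ j i, F (R' j) i ≠ 0 → outDeg ∅ j ≤ N := by
    intro j i hi
    obtain ⟨k, hk⟩ := hex j i hi
    rw [hR'] at hk
    have := hN _ hk
    rw [total_ext j hx] at this
    omega
  choose M hM using fun j => exists_total_le (F (R' j))
  obtain ⟨P, hP⟩ := exists_cAnn_of_total_le (Γ := Γ₁ ∪ Γ₂)
    (fun ψ => F (R' (ψ.restrict Finset.subset_union_right)) (ψ.restrict Finset.subset_union_left))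
    ((finite_total_le Γ₂ N).toFinset.sup M + N) (by
      intro ψ
      induction ψ using CIdx.join_cases with
      | h i j =>
        rw [CIdx.join_left, CIdx.join_right hΓ, outDeg_join hΓ]
        intro hi
        have hjN := hj j i hi
        refine add_le_add ((hM j i hi).trans ?_) hjN
        exact Finset.le_sup (f := M) (by simpa using hjN))
  have hP' : ∀ j i, F (R' j) i = P (i.join j) := fun j i => by
    rw [hP, CIdx.join_left, CIdx.join_right hΓ]
  refine ⟨P, .letBase x hS hΓ hx P R (fun j => F (R' j)) R' hP' hR' (fun j => ht₁ (R' j)) ht₂,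
    fun d n hQ ψ => ?_⟩
  induction ψ using CIdx.join_cases with
  | h i j =>
    rw [← hP', outDeg_join hΓ, outDeg_join hΓ]
    intro hi
    have hR : ∀ k, R' j k ≠ 0 → (if x ∈ V₂ then 0 else deg x.ty k) + outDeg V₂ j < d ∨
        (deg x.ty k + outDeg ∅ j ≤ d ∧ R' j k ≤ n) := by
      intro k hk
      rw [hR'] at hk ⊢
      exact (cBound_insert_iff hx R d n).1 (hb₂ d n hQ) j k hk
    obtain ⟨k₀, hk₀⟩ := hex j i hi
    have hle := outDeg_le_total V₂ j
    have hle₁ := outDeg_le_total V₁ i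
    by_cases hxV : x ∈ V₂
    · rw [if_pos hxV] at hV
      have h₁ : outDeg V i = 0 := by
        rw [outDeg_congr (V' := Γ₁) i fun z hz => by simp [hV, hz]]
        exact Finset.sum_eq_zero fun z hz => by simp [hz]
      have h₂ : outDeg V j ≤ outDeg V₂ j := outDeg_anti j fun z hz hzV => by
        have : z ≠ x := fun h => hx (h ▸ hz)
        simp [hV, hzV, this]
      simp only [if_pos hxV, zero_add] at hR
      by_cases hd : outDeg V₂ j < d
      · exact Or.inl (by omega)
      -- the index `j` carries the full degree, so that `R' j` is bounded by a constant
      · have hb : Bound (R' j) 0 n := fun k hk => by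
          have := (hR k hk).resolve_left hd
          exact Or.inr ⟨by omega, this.2⟩
        have hi' := (hb₁ _ 0 n hb i hi).resolve_left (Nat.not_lt_zero _)
        have := ((hR k₀ hk₀).resolve_left hd).1
        exact Or.inr ⟨by omega, hi'.2⟩
    · rw [if_neg hxV] at hV
      have h₁ : outDeg V i ≤ outDeg V₁ i := outDeg_anti i fun z _ hz => by simp [hV, hz]
      have h₂ : outDeg V j ≤ outDeg V₂ j := outDeg_anti j fun z _ hz => by simp [hV, hz]
      simp only [if_neg hxV] at hR
      have hjd : outDeg V₂ j ≤ d := by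
        rcases hR k₀ hk₀ with h | h <;> omega
      by_cases heq : outDeg V₂ j = outDeg ∅ j
      · have hb : Bound (R' j) (d - outDeg V₂ j) n := fun k hk => by
          rcases hR k hk with h | h
          · exact Or.inl (by omega)
          · exact Or.inr ⟨by omega, h.2⟩
        rcases hb₁ _ _ n hb i hi with h | h
        · exact Or.inl (by omega)
        · exact Or.inr ⟨by omega, h.2⟩
      -- some variable in `V₂` contributes to `j`, so that the degree is below the maximum
      · have hlt : ∀ k, R' j k ≠ 0 → deg x.ty k + outDeg V₂ j < d := fun k hk => by
          rcases hR k hk with h | h <;> omega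
        obtain ⟨m, hm⟩ := exists_bound_of_deg_le (R' j) (d - outDeg V₂ j - 1) fun k hk => by
          have := hlt k hk
          omega
        have := (hb₁ _ _ m hm).outDeg_le i hi
        have := hlt k₀ hk₀
        exact Or.inl (by omega)

theorem Controlled.weaken {T : FAnn} {S₁ S₂ : Finset FVar} {Γ₁ Γ₂ V₁ V₂ : Finset BVar}
    {e : Tm} {b : Ty} (hS : S₁ ⊆ S₂) (hΓ : Γ₁ ⊆ Γ₂) (hV : V₁ ⊆ V₂)
    (h : Controlled T S₁ Γ₁ e b V₁) : Controlled T S₂ Γ₂ e b V₂ := by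
  classical
  intro Q
  obtain ⟨P₁, ht, hb⟩ := h Q
  obtain ⟨N, hN⟩ := exists_total_le P₁
  have hne : ∀ γ : CIdx Γ₂, (if γ.ZeroOff Γ₁ then P₁ (γ.restrict hΓ) else 0) ≠ 0 →
      γ.ZeroOff Γ₁ ∧ P₁ (γ.restrict hΓ) ≠ 0 := fun γ hγ => by
    by_cases h0 : γ.ZeroOff Γ₁
    · exact ⟨h0, by rwa [if_pos h0] at hγ⟩
    · simp [h0] at hγ
  obtain ⟨P₂, hP₂⟩ := exists_cAnn_of_total_le (Γ := Γ₂)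
    (fun γ => if γ.ZeroOff Γ₁ then P₁ (γ.restrict hΓ) else 0) N fun γ hγ => by
      obtain ⟨h0, hγ⟩ := hne γ hγ
      exact outDeg_restrict ∅ γ hΓ h0 ▸ hN _ hγ
  refine ⟨P₂, .weak hS hΓ P₁ P₂ (fun γ h0 => by rw [hP₂, if_pos h0]) ht, fun d n hQ =>
    CBound.of_subset (V := V₁) (fun γ hγ => ?_) hV⟩
  rw [hP₂] at hγ ⊢
  obtain ⟨h0, hγ'⟩ := hne γ hγ
  have := hb d n hQ _ hγ'
  rw [if_pos h0]
  rwa [outDeg_restrict V₁ γ hΓ h0, outDeg_restrict ∅ γ hΓ h0] at this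

/-! ### Primitive recursion -/

theorem potential_add {b : Ty} (r s : Ann b) (v : Val b) :
    potential (r + s : Ann b) v = potential r v + potential s v := by
  simp only [potential_eq_linearCombination, map_add]

theorem potential₂_add {b : Ty} (q q' : Idx b × Idx b →₀ NNRat) (v : Val b) :
    potential₂ (fun k₁ k₂ => (q + q') (k₁, k₂)) v =
      potential₂ (fun k₁ k₂ => q (k₁, k₂)) v + potential₂ (fun k₁ k₂ => q' (k₁, k₂)) v := by
  simp only [potential₂_eq_linearCombination, map_add]

/-- An annotation of lists, viewed as one of two copies of a list that ignores the second. -/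
theorem exists_potential₂_eq {b : Ty} (s : Ann (.list b)) :
    ∃ q : Idx (.list b) × Idx (.list b) →₀ NNRat,
      (∀ k₁ k₂, q (k₁, k₂) = constCoeff (deg (.list b) k₂ = 0) (s k₁)) ∧
        ∀ v, potential₂ (fun k₁ k₂ => q (k₁, k₂)) v = potential s v := by
  have hinj : Function.Injective fun k : Idx (.list b) => (k, nilIdx b) :=
    fun _ _ h => congrArg Prod.fst h
  refine ⟨s.mapDomain fun k => (k, nilIdx b), fun k₁ k₂ => ?_, fun v => ?_⟩
  · unfold constCoeff
    split_ifs with h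
    · rw [(deg_list_eq_zero k₂).1 h]
      exact Finsupp.mapDomain_apply hinj s k₁
    · refine Finsupp.mapDomain_of_notMem_range s (k₁, k₂) ?_
      rintro ⟨k, hk⟩
      exact h ((deg_list_eq_zero k₂).2 (congrArg Prod.snd hk).symm)
  · rw [potential₂_eq_linearCombination, potential_eq_linearCombination,
      Finsupp.linearCombination_mapDomain]
    congr 2
    funext k
    simp [basePoly_nilIdx]

theorem outDeg_ctx₃ {V : Finset BVar} {x y z : BVar} (hxy : x ≠ y) (hzx : z ≠ x) (hzy : z ≠ y)
    (γ : CIdx (ctx₃ x y z)) : outDeg V γ =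
      (if x ∈ V then 0 else deg x.ty (γ x (by simp))) +
      ((if y ∈ V then 0 else deg y.ty (γ y (by simp))) +
        (if z ∈ V then 0 else deg z.ty (γ z (by simp)))) := by
  unfold outDeg
  rw [Finset.sum_insert (by simp [hxy, hzx.symm]), Finset.sum_pair hzy.symm]
  simp

theorem idx₃_fst {x y z : BVar} (i : Idx x.ty) (j : Idx y.ty) (k : Idx z.ty)
    (h : x ∈ ctx₃ x y z) : idx₃ x y z i j k x h = i :=
  CIdx.ext_self _ _ _ h

theorem idx₃_snd {x y z : BVar} (hxy : x ≠ y) (i : Idx x.ty) (j : Idx y.ty) (k : Idx z.ty)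
    (h : y ∈ ctx₃ x y z) : idx₃ x y z i j k y h = j :=
  (CIdx.ext_of_ne _ _ _ h hxy.symm).trans (CIdx.ext_self _ _ _ _)

theorem idx₃_thd {x y z : BVar} (hzx : z ≠ x) (hzy : z ≠ y) (i : Idx x.ty) (j : Idx y.ty)
    (k : Idx z.ty) (h : z ∈ ctx₃ x y z) : idx₃ x y z i j k z h = k :=
  (CIdx.ext_of_ne _ _ _ h hzx).trans ((CIdx.ext_of_ne _ _ _ _ hzy).trans rfl)

theorem idx₃_eta {x y z : BVar} (hxy : x ≠ y) (hzx : z ≠ x) (hzy : z ≠ y)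
    (γ : CIdx (ctx₃ x y z)) :
    idx₃ x y z (γ x (by simp)) (γ y (by simp)) (γ z (by simp)) = γ := by
  funext w hw
  have hw' : w = x ∨ w = y ∨ w = z := by simpa using hw
  rcases hw' with rfl | rfl | rfl
  · exact idx₃_fst _ _ _ hw
  · exact idx₃_snd hxy _ _ _ hw
  · exact idx₃_thd hzx hzy _ _ _ hw

/-- One unfolding of a recursion whose output has degree `d`. The part of the demand of the step
`e₁` on the recursive result that has degree below `d` is met by the recursive calls of lower
degree that `G` supplies; the part of degree `d` is uniform, and is met by the annotation `Q`
itself. The potential that the recursive calls take from the tail of the list is moved to the whole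
list by prepending the index of the head. -/
theorem Controlled.primrec_step {T : FAnn} {S : Finset FVar} {Γ V : Finset BVar} {e₀ e₁ : Tm}
    {x y ys z : ℕ} {b b₂ : Ty} (hx : BVar.mk x (.list b) ∉ Γ)
    (hzy : BVar.mk z b₂ ≠ BVar.mk y b) (hzys : BVar.mk z b₂ ≠ BVar.mk ys (.list b))
    (h₀ : Controlled T S Γ e₀ b₂ V)
    (h₁ : Controlled T ∅ (ctx₃ (BVar.mk y b) (BVar.mk ys (.list b)) (BVar.mk z b₂)) e₁ b₂
      {BVar.mk y b, BVar.mk ys (.list b)})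
    {d n : ℕ} {Q : Ann b₂} (hQ : Uniform Q d n) (hd : d = 0 ∨ ∃ i, deg b₂ i = d ∧ Q i ≠ 0)
    (G : Ann b₂ → CAnn (insert (BVar.mk x (.list b)) Γ)) (hG0 : G 0 = 0)
    (hG : ∀ Q', Q' ≠ 0 → (∀ i, Q' i ≠ 0 → deg b₂ i < d) →
      Typed T S (insert (BVar.mk x (.list b)) Γ) (G Q')
        (.primrec (BVar.mk x (.list b)) e₀ (BVar.mk y b) (BVar.mk ys (.list b)) (BVar.mk z b₂) e₁)
        (.base b₂ Q') ∧ ∀ γ, G Q' γ ≠ 0 → outDeg (V ∪ {BVar.mk x (.list b)}) γ < d) :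
    ∃ P, Typed T S (insert (BVar.mk x (.list b)) Γ) P
        (.primrec (BVar.mk x (.list b)) e₀ (BVar.mk y b) (BVar.mk ys (.list b)) (BVar.mk z b₂) e₁)
        (.base b₂ Q) ∧ CBound P d n (V ∪ {BVar.mk x (.list b)}) := by
  classical
  have hyys := bvar_ne_list y ys b
  have htot : ∀ γ : CIdx (ctx₃ (BVar.mk y b) (BVar.mk ys (.list b)) (BVar.mk z b₂)),
      outDeg ∅ γ = deg b (γ (BVar.mk y b) (by simp)) +
        (deg (.list b) (γ (BVar.mk ys (.list b)) (by simp)) +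
          deg b₂ (γ (BVar.mk z b₂) (by simp))) := fun γ => by
    rw [outDeg_ctx₃ hyys hzy hzys]
    rfl
  obtain ⟨P₀, ht₀, hb₀⟩ := h₀ Q
  replace hb₀ := hb₀ d n hQ.bound
  obtain ⟨Pe, hte, hbe⟩ := h₁ Q
  replace hbe := hbe d n hQ.bound
  obtain ⟨N₀, hN₀⟩ := exists_total_le P₀
  obtain ⟨N, hN⟩ := exists_total_le Pe
  -- the demand of `e₁` below degree `d`
  let c : Idx b → Idx (.list b) → Idx b₂ → NNRat := fun j l k =>
    if deg b₂ k < d then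
      Pe (idx₃ (BVar.mk y b) (BVar.mk ys (.list b)) (BVar.mk z b₂) j l k) else 0
  have hc : ∀ j l k, c j l k ≠ 0 →
      deg b₂ k < d ∧ deg b j + (deg (.list b) l + deg b₂ k) ≤ N := by
    intro j l k hk
    by_cases hkd : deg b₂ k < d
    · refine ⟨hkd, ?_⟩
      simp only [c, if_pos hkd] at hk
      have := hN _ hk
      rw [outDeg_ctx₃ hyys hzy hzys] at this
      simpa [idx₃_fst, idx₃_snd hyys, idx₃_thd hzy hzys] using this
    · simp [c, hkd] at hk
  choose R hR using fun j l => exists_finsupp_of_deg_le (c j l) N fun k hk => by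
    have := (hc j l k hk).2
    omega
  obtain ⟨Q', hQ'⟩ := exists_finsupp_of_deg_le (b := .prod b (.list b))
    (fun p : Idx b × Idx (.list b) => R p.1 p.2) N (by
      rintro ⟨j, l⟩ hp
      obtain ⟨k, hk⟩ := Finsupp.ne_iff.1 hp
      rw [hR] at hk
      have := (hc j l k hk).2
      change deg b j + deg (.list b) l ≤ N
      omega)
  have hQ'c : ∀ j l k, Q' (j, l) k = c j l k := fun j l k =>
    (congrArg (fun r : Ann b₂ => r k) (hQ' (j, l))).trans (hR j l k)
  have hQ'd : ∀ (p : Idx b × Idx (.list b)) k, Q' p k ≠ 0 → deg b₂ k < d := fun ⟨j, l⟩ k hk =>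
    (hc j l k (hQ'c j l k ▸ hk)).1
  let P' : Idx b × Idx (.list b) →₀ CAnn (insert (BVar.mk x (.list b)) Γ) := Q'.mapRange G hG0
  have hP' : ∀ p, P' p = G (Q' p) := fun p => Finsupp.mapRange_apply
  have hcall : ∀ p, P' p ≠ 0 → Q' p ≠ 0 := fun p hp h => hp (by rw [hP', h, hG0])
  choose M hM using fun P : CAnn (insert (BVar.mk x (.list b)) Γ) => exists_total_le P
  have hN' : ∀ p γ, P' p γ ≠ 0 → outDeg ∅ γ ≤ P'.support.sup fun p => M (P' p) := by
    intro p γ hγ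
    refine (hM _ γ hγ).trans (Finset.le_sup (f := fun p => M (P' p)) ?_)
    rw [Finsupp.mem_support_iff]
    exact fun h => hγ (by rw [h]; rfl)
  generalize P'.support.sup (fun p => M (P' p)) = N' at hN'
  obtain ⟨N'', hN''⟩ : ∃ N'', ∀ j l, P' (j, l) ≠ 0 → deg b j + deg (.list b) l ≤ N'' := by
    obtain ⟨N'', h⟩ := exists_deg_le (b := .prod b (.list b)) P'
    exact ⟨N'', fun j l => h (j, l)⟩
  have hne : ∀ p γ, P' p γ ≠ 0 → P' p ≠ 0 := fun p γ hγ h => hγ (by rw [h]; rfl)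
  have hq : ∀ (γ : CIdx Γ) (j : Idx b), ∃ q : Idx (.list b) × Idx (.list b) →₀ NNRat,
      ∀ k₁ k₂, q (k₁, k₂) = slice (BVar.mk x (.list b)) (P' (j, k₂)) γ k₁ := by
    intro γ j
    obtain ⟨q, hq⟩ := exists_finsupp_of_deg_le (b := .prod (.list b) (.list b))
      (fun k : Idx (.list b) × Idx (.list b) =>
        slice (BVar.mk x (.list b)) (P' (j, k.2)) γ k.1) (N' + N'') (by
        rintro ⟨k₁, k₂⟩ hk
        have h₁ := hN' _ _ hk
        have h₂ := hN'' _ _ (hne _ _ hk)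
        rw [total_ext γ hx] at h₁
        change deg (.list b) k₁ + deg (.list b) k₂ ≤ N' + N''
        dsimp only at h₁ h₂
        omega)
    exact ⟨q, fun k₁ k₂ => hq (k₁, k₂)⟩
  choose q hq using hq
  choose r hr hrdeg _ using fun γ j => exists_linearization (q γ j)
  have hrne : ∀ γ j k, r γ j k ≠ 0 → ∃ k₁ k₂,
      P' (j, k₂) (γ.ext (BVar.mk x (.list b)) k₁) ≠ 0 ∧
        deg (.list b) k ≤ deg (.list b) k₁ + deg (.list b) k₂ := by
    intro γ j k hk
    obtain ⟨k₁, k₂, hk', hle⟩ := hrdeg γ j k hk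
    rw [hq] at hk'
    exact ⟨k₁, k₂, hk', hle⟩
  let f : CIdx Γ → List (Idx b) → NNRat := fun γ k =>
    match k with
    | [] => P₀ γ
    | j :: k => r γ j k
  obtain ⟨P, hP⟩ := exists_cAnn_insert hx f (N₀ + N' + N'' + 1) (by
    intro γ k hk
    induction k using idxList_cases with
    | hnil =>
      have : outDeg ∅ γ ≤ N₀ := hN₀ γ hk
      change 0 + outDeg ∅ γ ≤ _
      omega
    | hcons j k =>
      obtain ⟨k₁, k₂, hne', hle⟩ := hrne γ j k hk
      have h₁ := hN' _ _ hne'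
      have h₂ := hN'' _ _ (hne _ _ hne')
      rw [total_ext γ hx] at h₁
      dsimp only at h₁ ⊢
      rw [deg_consIdx]
      omega)
  have hPnil : ∀ γ, slice (BVar.mk x (.list b)) P γ (nilIdx b) = P₀ γ := fun γ => hP γ (nilIdx b)
  have hPcons : ∀ γ j k, slice (BVar.mk x (.list b)) P γ (consIdx j k) = r γ j k :=
    fun γ j k => hP γ (consIdx j k)
  choose s hs using exists_ann_slice hx P
  obtain ⟨P₁, hP₁⟩ := exists_cAnn_of_total_le
    (fun γ : CIdx (ctx₃ (BVar.mk y b) (BVar.mk ys (.list b)) (BVar.mk z b₂)) =>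
      callCoeff Q (Q' (γ (BVar.mk y b) (by simp), γ (BVar.mk ys (.list b)) (by simp)))
        (γ (BVar.mk y b) (by simp)) (γ (BVar.mk ys (.list b)) (by simp))
        (γ (BVar.mk z b₂) (by simp))) (N + d) (by
    intro γ hγ
    rw [htot]
    by_cases hk : c (γ (BVar.mk y b) (by simp)) (γ (BVar.mk ys (.list b)) (by simp))
        (γ (BVar.mk z b₂) (by simp)) = 0
    · rw [callCoeff, hQ'c, hk, add_zero, constCoeff] at hγ
      by_cases h : deg b (γ (BVar.mk y b) (by simp)) = 0 ∧
          deg (.list b) (γ (BVar.mk ys (.list b)) (by simp)) = 0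
      · rw [if_pos h] at hγ
        have := hQ.1 _ hγ
        omega
      · exact absurd (if_neg h) hγ
    · have := (hc _ _ _ hk).2
      omega)
  refine ⟨P, .primrec x y ys z b b₂ hx hzy hzys P Q P₀ P₁ P' Q' (fun γ => (hPnil γ).symm)
    (fun γ j v => ?_) (fun j l k => ?_) (fun p k hk => ?_) (fun p hp => ?_) ht₀
    (.sup Pe P₁ (fun γ => ?_) hte), ?_⟩
  · -- the potential of the tail splits into what the recursive calls take
    obtain ⟨q₀, hq₀, hq₀v⟩ := exists_potential₂_eq (if deg b j = 0 then s γ else 0)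
    have hl : shift (slice (BVar.mk x (.list b)) P γ) j =
        (r γ j + (if deg b j = 0 then s γ else 0) : Ann (.list b)) := by
      funext k
      rw [shift, hPcons, Finsupp.add_apply]
      split_ifs
      · rw [hs]
        rfl
      · rfl
    have hr' : (fun k₁ k₂ : Idx (.list b) => callCoeff (slice (BVar.mk x (.list b)) P γ)
        (slice (BVar.mk x (.list b)) (P' (j, k₂)) γ) j k₂ k₁) =
        fun k₁ k₂ => (q γ j + q₀) (k₁, k₂) := by
      funext k₁ k₂
      rw [callCoeff, Finsupp.add_apply, hq, hq₀, add_comm]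
      congr 1
      unfold constCoeff
      by_cases hj : deg b j = 0
      · simp only [hj, true_and, if_true]
        rw [hs]
        rfl
      · simp [hj]
    rw [hl, hr', potential_add, potential₂_add, hr, hq₀v]
  · rw [hP₁]
    simp only [idx₃_fst, idx₃_snd hyys, idx₃_thd hzy hzys]
    rfl
  · rcases hd with h0 | ⟨i, hi, hQi⟩
    · have := hQ'd p k hk
      omega
    · exact ⟨i, hQi, hi ▸ hQ'd p k hk⟩
  · rw [hP']
    exact (hG _ (hp.elim (hcall p) id) (hQ'd p)).1
  · rw [hP₁]
    by_cases hγ : Pe γ = 0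
    · simp [hγ]
    have hout : outDeg {BVar.mk y b, BVar.mk ys (.list b)} γ =
        deg b₂ (γ (BVar.mk z b₂) (by simp)) := by
      rw [outDeg_ctx₃ hyys hzy hzys]
      simp [hzy, hzys]
    have htotγ := htot γ
    by_cases hk : deg b₂ (γ (BVar.mk z b₂) (by simp)) < d
    · rw [callCoeff, hQ'c]
      simp only [c, if_pos hk, idx₃_eta hyys hzy hzys]
      exact le_add_self
    -- a demand of degree `d` on the recursive result only occurs at the zero index of head and
    -- tail, where `Q` is used, and there it is at most `n`
    · rcases hbe γ hγ with h | h
      · omega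
      · have h0 : deg b (γ (BVar.mk y b) (by simp)) = 0 ∧
            deg (.list b) (γ (BVar.mk ys (.list b)) (by simp)) = 0 := by omega
        rw [callCoeff, constCoeff, if_pos h0, hQ.2 _ (by omega)]
        exact h.2.trans le_self_add
  · have hxV : BVar.mk x (.list b) ∈ V ∪ {BVar.mk x (.list b)} := by simp
    rw [cBound_insert_iff hx]
    intro γ k hk
    rw [if_pos hxV, zero_add]
    induction k using idxList_cases with
    | hnil =>
      change slice (BVar.mk x (.list b)) P γ (nilIdx b) ≠ 0 at hk
      change outDeg (V ∪ {BVar.mk x (.list b)}) γ < d ∨ 0 + outDeg ∅ γ ≤ d ∧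
        slice (BVar.mk x (.list b)) P γ (nilIdx b) ≤ n
      rw [hPnil] at hk ⊢
      rw [zero_add]
      exact hb₀.of_subset Finset.subset_union_left γ hk
    | hcons j k =>
      change slice (BVar.mk x (.list b)) P γ (consIdx j k) ≠ 0 at hk
      rw [hPcons] at hk
      obtain ⟨k₁, k₂, hne', -⟩ := hrne γ j k hk
      have hQne := hcall _ (hne _ _ hne')
      rw [hP'] at hne'
      have := (hG _ hQne (hQ'd _)).2 _ hne'
      rw [outDeg_ext_of_mem γ hx _ hxV] at this
      exact Or.inl this

theorem Controlled.primrec {T : FAnn} {S : Finset FVar} {Γ V : Finset BVar} {e₀ e₁ : Tm}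
    {x y ys z : ℕ} {b b₂ : Ty} (hx : BVar.mk x (.list b) ∉ Γ)
    (hzy : BVar.mk z b₂ ≠ BVar.mk y b) (hzys : BVar.mk z b₂ ≠ BVar.mk ys (.list b))
    (h₀ : Controlled T S Γ e₀ b₂ V)
    (h₁ : Controlled T ∅ (ctx₃ (BVar.mk y b) (BVar.mk ys (.list b)) (BVar.mk z b₂)) e₁ b₂
      {BVar.mk y b, BVar.mk ys (.list b)}) :
    Controlled T S (insert (BVar.mk x (.list b)) Γ)
      (.primrec (BVar.mk x (.list b)) e₀ (BVar.mk y b) (BVar.mk ys (.list b)) (BVar.mk z b₂) e₁)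
      b₂ (V ∪ {BVar.mk x (.list b)}) := by
  have key : ∀ (d n : ℕ) (Q : Ann b₂), Bound Q d n →
      ∃ P, Typed T S (insert (BVar.mk x (.list b)) Γ) P (.primrec (BVar.mk x (.list b)) e₀
        (BVar.mk y b) (BVar.mk ys (.list b)) (BVar.mk z b₂) e₁) (.base b₂ Q) ∧
        CBound P d n (V ∪ {BVar.mk x (.list b)}) := by
    intro d
    induction d using Nat.strong_induction_on with
    | _ d ih =>
      intro n Q hQ
      -- the induction hypothesis, for annotations of degree below `d`
      have hlow : ∀ Q' : Ann b₂, (∀ i, Q' i ≠ 0 → deg b₂ i < d) → d ≠ 0 →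
          ∃ P, Typed T S (insert (BVar.mk x (.list b)) Γ) P (.primrec (BVar.mk x (.list b)) e₀
            (BVar.mk y b) (BVar.mk ys (.list b)) (BVar.mk z b₂) e₁) (.base b₂ Q') ∧
            ∀ γ, P γ ≠ 0 → outDeg (V ∪ {BVar.mk x (.list b)}) γ < d := by
        intro Q' hQ' hd
        obtain ⟨m, hm⟩ := exists_bound_of_deg_le Q' (d - 1) fun i hi => by
          have := hQ' i hi
          omega
        obtain ⟨P, hP, hPb⟩ := ih (d - 1) (by omega) m Q' hm
        refine ⟨P, hP, fun γ hγ => ?_⟩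
        have := hPb.outDeg_le γ hγ
        omega
      by_cases hd : d = 0 ∨ ∃ i, deg b₂ i = d ∧ Q i ≠ 0
      · obtain ⟨Q₁, hle, hQ₁⟩ := hQ.exists_uniform
        have hG : ∀ Q' : Ann b₂, ∃ P : CAnn (insert (BVar.mk x (.list b)) Γ), (Q' = 0 → P = 0) ∧
            (Q' ≠ 0 → (∀ i, Q' i ≠ 0 → deg b₂ i < d) →
              Typed T S (insert (BVar.mk x (.list b)) Γ) P (.primrec (BVar.mk x (.list b)) e₀
                (BVar.mk y b) (BVar.mk ys (.list b)) (BVar.mk z b₂) e₁) (.base b₂ Q') ∧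
              ∀ γ, P γ ≠ 0 → outDeg (V ∪ {BVar.mk x (.list b)}) γ < d) := by
          intro Q'
          by_cases hQ' : Q' ≠ 0 ∧ ∀ i, Q' i ≠ 0 → deg b₂ i < d
          · obtain ⟨i, hi⟩ := Finsupp.ne_iff.1 hQ'.1
            have := hQ'.2 i hi
            obtain ⟨P, hP⟩ := hlow Q' hQ'.2 (by omega)
            exact ⟨P, fun h => absurd h hQ'.1, fun _ _ => hP⟩
          · exact ⟨0, fun _ => rfl, fun h h' => absurd ⟨h, h'⟩ hQ'⟩
        choose G hG0 hG using hG
        obtain ⟨P, hP, hPb⟩ := Controlled.primrec_step hx hzy hzys h₀ h₁ hQ₁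
          (hd.imp_right fun ⟨i, hi, hQi⟩ => ⟨i, hi, fun h => hQi (by simpa [h] using hle i)⟩)
          G (hG0 0 rfl) hG
        exact ⟨P, .sub P Q₁ Q hle hP, hPb⟩
      · push Not at hd
        obtain ⟨P, hP, hPb⟩ := hlow Q (fun i hi => lt_of_le_of_ne (hQ.deg_le i hi) fun h =>
          hi (hd.2 i h)) hd.1
        exact ⟨P, hP, fun γ hγ => Or.inl (hPb γ hγ)⟩
  intro Q
  obtain ⟨d, n, hQ, hmin⟩ := exists_least_bound Q
  obtain ⟨P, hP, hPb⟩ := key d n Q hQ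
  exact ⟨P, hP, fun d' n' h => hPb.mono (hmin d' n' h)⟩

/-! ### Induction on derivations -/

/-- The sets of annotated arrow types fit the time classes recorded in `Δ`. -/
def FitsAll (T : FAnn) (Δ : Set (FVar × Time)) : Prop :=
  ∀ (f : FVar) (t : Time), (f, t) ∈ Δ → WeaklyFits (T f) t

/-- What is proved of a term: a term of base type is controlled, and a term of arrow type has a
set of annotated types that weakly fits its time class. -/
def Meaning (T : FAnn) (S : Finset FVar) (Γ : Finset BVar) (e : Tm) : STy → Claim → Prop
  | .base b, .inhpoly V => Controlled T S Γ e b V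
  | .arrow b₁ b₂, .time t =>
      WeaklyFits {a : Ann b₁ × Ann b₂ | Typed T S Γ 0 e (.arrow b₁ b₂ a.1 a.2)} t
  | _, _ => True

theorem FitsAll.mono {T : FAnn} {Δ₁ Δ₂ : Set (FVar × Time)} (h : FitsAll T Δ₂) (hΔ : Δ₁ ⊆ Δ₂) :
    FitsAll T Δ₁ :=
  fun f t hf => h f t (hΔ hf)

theorem Controlled.weaklyFits_lam {T : FAnn} {S : Finset FVar} {x : BVar} {e : Tm} {b : Ty}
    {V : Finset BVar} {t : Time} (h : Controlled T S {x} e b V) (hV : t = .const → V = ∅) :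
    WeaklyFits {a : Ann x.ty × Ann b | Typed T S ∅ 0 (.lam x e) (.arrow x.ty b a.1 a.2)} t := by
  intro Q
  obtain ⟨P, hP, hb⟩ := h.lam Q
  exact ⟨Q, P, le_rfl, hP, fun d n hQ ht => hb d n hQ (ht.imp_left hV)⟩

theorem FitsAll.update {T : FAnn} {Δ : Set (FVar × Time)} {S : Finset FVar} {f : FVar}
    {t : Time} {A : Set (Ann f.dom × Ann f.cod)} (hf : f ∉ S) (hΔ : Declared Δ S)
    (h : FitsAll T Δ) (hA : WeaklyFits A t) :
    FitsAll (Function.update T f A) (insert (f, t) Δ) := by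
  rintro g u (hg | hg)
  · obtain ⟨rfl, rfl⟩ := Prod.mk.inj hg
    rwa [Function.update_self]
  · have hne : g ≠ f := fun h => hf (h ▸ hΔ _ hg)
    rw [Function.update_of_ne hne]
    exact h g u hg

theorem FitsAll.replaceFun {T : FAnn} {Δ : Set (FVar × Time)} {S : Finset FVar}
    {f f₁ f₂ : ℕ} {b₁ b₂ : Ty} (hf₁ : ⟨f₁, b₁, b₂⟩ ∉ S) (hf₂ : ⟨f₂, b₁, b₂⟩ ∉ S)
    (hΔ : Declared Δ (insert ⟨f, b₁, b₂⟩ S)) (h : FitsAll T Δ) :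
    FitsAll (Function.update (Function.update T ⟨f₁, b₁, b₂⟩ (T ⟨f, b₁, b₂⟩))
      ⟨f₂, b₁, b₂⟩ (T ⟨f, b₁, b₂⟩)) (replaceFun Δ ⟨f, b₁, b₂⟩ ⟨f₁, b₁, b₂⟩ ⟨f₂, b₁, b₂⟩) := by
  rintro g t (⟨hg, hne⟩ | ⟨hg, hft⟩)
  · have hgS : g ∈ S := (Finset.mem_insert.1 (hΔ _ hg)).resolve_left hne
    have hg₁ : g ≠ ⟨f₁, b₁, b₂⟩ := fun h => hf₁ (h ▸ hgS)
    have hg₂ : g ≠ ⟨f₂, b₁, b₂⟩ := fun h => hf₂ (h ▸ hgS)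
    rw [Function.update_of_ne hg₂, Function.update_of_ne hg₁]
    exact h g t hg
  · by_cases h₂ : g = ⟨f₂, b₁, b₂⟩
    · subst h₂
      rw [Function.update_self]
      exact h _ t hft
    · obtain rfl : g = ⟨f₁, b₁, b₂⟩ := hg.resolve_right h₂
      rw [Function.update_of_ne h₂, Function.update_self]
      exact h _ t hft

/-- The annotation `T` of the arrow-type variables is quantified inside the induction, as `let` and
`share` for such variables extend it. -/
theorem InhPoly.meaning {Δ : Set (FVar × Time)} {S : Finset FVar} {Γ : Finset BVar} {e : Tm}
    {τ : STy} {c : Claim} (h : InhPoly True Δ S Γ e τ c) (T : FAnn) (hT : FitsAll T Δ) :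
    Meaning T S Γ e τ c := by
  induction h generalizing T with
  | base x => exact .var T x
  | arrow f t =>
    intro Q
    obtain ⟨Q', P, hle, hmem, hb⟩ := hT f t rfl Q
    exact ⟨Q', P, hle, .fvar f P Q' hmem, hb⟩
  | sumL x b₂ => exact .inl T x b₂
  | sumR x b₁ => exact .inr T x b₁
  | pair x₁ x₂ hne => exact .pair T hne
  | unit => exact .unit T
  | nil b => exact .nil T b
  | cons n₁ n₂ b => exact .cons T n₁ n₂ b
  | appConst n m b₁ b₂ => exact .app n m (hT _ _ rfl) (Or.inl rfl)
  | appPoly n m b₁ b₂ => exact .app n m (hT _ _ rfl) (Or.inr (Finset.mem_singleton_self _))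
  | caseSum x y₁ y₂ b₁ b₂ hx hy₁ hy₂ hV _ _ ih₁ ih₂ =>
    exact .caseSum hx hy₁ hy₂ hV (ih₁ T hT) (ih₂ T hT)
  | caseProd x x₁ x₂ b₁ b₂ hx hx₁ hx₂ hne hV _ ih =>
    exact .casePair hx hx₁ hx₂ hne hV (ih T hT)
  | caseList x y ys b hr hx hy hys hV _ _ ih₀ ih₁ =>
    exact .caseList (hr trivial) hx hy hys hV (ih₀ T hT) (ih₁ T hT)
  | primrec x y ys z b b₂ hx hzy hzys _ _ ih₀ ih₁ =>
    exact .primrec hx hzy hzys (ih₀ T hT) (ih₁ T fun _ _ h => h.elim)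
  | letBase x hS hΓ hx _ _ ih₁ ih₂ =>
    exact .letBase hS hΓ hx rfl (ih₁ T (hT.mono Set.subset_union_left))
      (ih₂ T (hT.mono Set.subset_union_right))
  | letArrow f t hS hf hΔ _ _ ih₁ ih₂ =>
    intro Q
    obtain ⟨P, hP, hb⟩ := ih₂ _
      ((hT.mono Set.subset_union_right).update hf hΔ (ih₁ T (hT.mono Set.subset_union_left))) Q
    exact ⟨P, .letArrow f hS hf P _ (fun _ ha => ha) hP, hb⟩
  | shareBase x x₁ x₂ b' hr hx hx₁ hx₂ hne hV _ ih =>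
    exact .shareBase (hr trivial) hx hx₁ hx₂ hne hV (ih T hT)
  | shareArrow f f₁ f₂ b₁ b₂ hf hf₁ hf₂ hne hΔ _ ih =>
    intro Q
    obtain ⟨P, hP, hb⟩ := ih _ (hT.replaceFun hf₁ hf₂ hΔ) Q
    exact ⟨P, .shareArrow f f₁ f₂ b₁ b₂ hf hf₁ hf₂ hne P hP, hb⟩
  | weakenBase hΔ hS hΓ hV _ _ _ ih =>
    exact Controlled.weaken hS hΓ hV (ih T (hT.mono hΔ))
  | const x _ ih => exact Controlled.weaklyFits_lam (ih T hT) fun _ => rfl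
  | poly x _ ih => exact Controlled.weaklyFits_lam (ih T hT) nofun

/-- The bounds of the input annotation of a `λ`-abstraction can be made exact by raising it. -/
theorem Controlled.exists_uniform_lam {T : FAnn} {S : Finset FVar} {x : BVar} {e : Tm} {b : Ty}
    {V : Finset BVar} (h : Controlled T S {x} e b V) {d n : ℕ} {Q : Ann b} (hQ : Uniform Q d n)
    {t : Time} (hV : t = .const → V = ∅) : ∃ P : Ann x.ty,
      Typed T S ∅ 0 (.lam x e) (.arrow x.ty b P Q) ∧ (t = .const ∨ d = 0 → Uniform P d n) := by
  obtain ⟨P₁, hP₁, hb⟩ := h Q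
  by_cases ht : t = .const ∨ d = 0
  · have hb' : CBound P₁ d n ∅ := by
      rcases ht with ht | rfl
      · exact hV ht ▸ hb d n hQ.bound
      · exact (hb 0 n hQ.bound).of_zero ∅
    obtain ⟨P₂, hle, hu⟩ := hb'.exists_cUniform
    obtain ⟨P, hP, -⟩ := exists_ann_of_cAnn_singleton P₂
    refine ⟨P, .lam x b P Q P₂ hP (.sup P₁ P₂ hle hP₁), fun _ => ?_⟩
    have hx := hu x (Finset.mem_singleton_self x) (Finset.notMem_empty x)
    have hP' : ∀ k, P k = P₂ (CIdx.single x k) := fun k => (hP (CIdx.single x k)).symm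
    refine ⟨fun k hk => ?_, fun k hk => ?_⟩
    · by_contra hlt
      exact hk ((hP' k).trans (hx.1 _ (not_le.1 hlt)))
    · exact (hP' k).trans (hx.2.2 _ hk fun z hz hz' => absurd hz hz')
  · obtain ⟨P, hP, -⟩ := exists_ann_of_cAnn_singleton P₁
    exact ⟨P, .lam x b P Q P₁ hP hP₁, fun h => absurd h ht⟩

end RaML

theorem mainTheorem3 (Δ : Set (RaML.FVar × RaML.Time)) (S : Finset RaML.FVar) (T : RaML.FAnn)
    (hT : ∀ (f : RaML.FVar) (t : RaML.Time), (f, t) ∈ Δ → RaML.Fits (T f) t) :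
    (∀ (Γ V : Finset RaML.BVar) (e : RaML.Tm) (b : RaML.Ty),
      RaML.InhPoly True Δ S Γ e (.base b) (.inhpoly V) →
      ∀ (d n : ℕ) (Q : RaML.Ann b), RaML.Uniform Q d n →
        ∃ P : RaML.CAnn Γ, RaML.Typed T S Γ P e (.base b Q) ∧ RaML.CUniform P d n V) ∧
    (∀ (e : RaML.Tm) (b₁ b₂ : RaML.Ty) (t : RaML.Time),
      RaML.InhPoly True Δ S ∅ e (.arrow b₁ b₂) (.time t) →
      ∀ (d n : ℕ) (Q : RaML.Ann b₂), RaML.Uniform Q d n →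
        ∃ P : RaML.Ann b₁, RaML.Typed T S ∅ 0 e (.arrow b₁ b₂ P Q) ∧
          (t = .const ∨ d = 0 → RaML.Uniform P d n)) := by
  have hT' : RaML.FitsAll T Δ := fun f t hf => (hT f t hf).weaklyFits
  refine ⟨fun Γ V e b h d n Q hQ => ?_, fun e b₁ b₂ t h d n Q hQ => ?_⟩
  · obtain ⟨P, hP, hb⟩ := h.meaning T hT' Q
    obtain ⟨P', hle, hu⟩ := (hb d n hQ.bound).exists_cUniform
    exact ⟨P', .sup P P' hle hP, hu⟩
  -- there are only two forms of terms of arrow type, variables and abstractions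
  · generalize hΓ : (∅ : Finset RaML.BVar) = Γ at h
    cases h with
    | arrow f t =>
      obtain ⟨P, hP, hu⟩ := hT f t rfl d n Q hQ
      exact ⟨P, .fvar f P Q hP, hu⟩
    | const x h =>
      exact RaML.Controlled.exists_uniform_lam (h.meaning T hT') hQ fun _ => rfl
    | poly x h =>
      exact RaML.Controlled.exists_uniform_lam (h.meaning T hT') hQ nofun
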